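/- Let $\mathbb H$ be the space of quaternions with its Euclidean metric $g_V$, regarded as a complex vector space through right multiplication ($\lambda\cdot q=q\lambda$ for $\lambda\in\mathbb C\subset\mathbb H$), and let $\omega_V(u,v)=g_V(ui,v)$. Let $\Gamma\subset\mathbb H$ be a lattice, let $M=\mathbb H/\Gamma$ be the quotient $4$-torus, with the induced flat metric $g_M$ and symplectic form $\omega_M$, oriented by $\omega_M^2$, and let $\rho:TM\to\mathbb H$ be the canonical trivialization. For a smooth map $f:M\to M$ let $\mathscr Df=\rho\circ f_*\in\Omega^1(M,\mathbb H)$. Left multiplications by $i,j,k$ on $\mathbb H$ induce almost complex structures $I,J,K$ on $M$, and the hyperKähler moment map $\boldsymbol\mu=(\mu_I,\mu_J,\mu_K)$ on $\Omega^1(M,\mathbb H)$ is given, for $\bullet=I,J,K$, by $\mu_\bullet(F)=-\tfrac12\, g(\mathscr R_\bullet F,F)$, where $\mathscr R_\bullet F=-(F\circ\bullet)\,i$ and $g$ is the pointwise inner product on $T^*M\otimes\mathbb H$ induced by $g_M$ and $g_V$. (1) A smooth map $f:M\to M$ is homotopic to a symplectic diffeomorphism of $(M,\omega_M)$ if and only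 if $f^*[\omega_M]=[\omega_M]$ in de Rham cohomology. (2) Let $f:M\to M$ be a smooth map that is homotopic to a symplectic diffeomorphism of $(M,\omega_M)$, or equivalently such that $f^*[\omega_M]=[\omega_M]$. Then $f$ is a symplectic diffeomorphism of $(M,\omega_M)$ if and only if $\boldsymbol\mu(\mathscr Df)=0$. (3) For every smooth map $f:M\to M$, the condition $\boldsymbol\mu(\mathscr Df)=0$ holds if and only if $f^*\omega_M$ is self-dual, and if and only if $f^*\omega_M$ is a self-dual harmonic form. (4) Every exact self-dual $2$-form on $M$ vanishes. -/

import Mathlib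

open scoped Manifold ContDiff Topology Quaternion

namespace HyperKahlerTorus

noncomputable section

/-! ### The quaternionic vector space and its linear structures -/

/-- The quaternion `i`. -/
def qi : ℍ[ℝ] := ⟨0, 1, 0, 0⟩

/-- The quaternion `j`. -/
def qj : ℍ[ℝ] := ⟨0, 0, 1, 0⟩

/-- The quaternion `k`. -/
def qk : ℍ[ℝ] := ⟨0, 0, 0, 1⟩

/-- The complex structure `v ↦ i · v := v i` of the complex vector space `ℍ`:
complex scalars act by quaternionic multiplication on the right. -/
def rightI : ℍ[ℝ] →L[ℝ] ℍ[ℝ] := (ContinuousLinearMap.mul ℝ ℍ[ℝ]).flip qi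

/-- The endomorphism `v ↦ q v`, quaternionic multiplication by `q` on the left. The almost complex
structures `I`, `J`, `K` are `leftMul qi`, `leftMul qj`, `leftMul qk`. -/
def leftMul (q : ℍ[ℝ]) : ℍ[ℝ] →L[ℝ] ℍ[ℝ] := ContinuousLinearMap.mul ℝ ℍ[ℝ] q

/-- The standard frame `1, i, j, k` of `ℍ`, orthonormal for the Euclidean metric
`g_V = inner ℝ`. -/
def frame : Fin 4 → ℍ[ℝ] := ![1, qi, qj, qk]

theorem inner_rightI_self (v : ℍ[ℝ]) : inner ℝ (rightI v) v = 0 := by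
  change inner ℝ (v * qi) v = 0
  have h0 : qi.re = 0 := rfl
  have h1 : qi.imI = 1 := rfl
  have h2 : qi.imJ = 0 := rfl
  have h3 : qi.imK = 0 := rfl
  simp only [Quaternion.inner_def, Quaternion.re_mul, Quaternion.imI_mul, Quaternion.imJ_mul,
    Quaternion.imK_mul, Quaternion.re_star, Quaternion.imI_star, Quaternion.imJ_star,
    Quaternion.imK_star, h0, h1, h2, h3]
  ring

/-- The symplectic form `ω_V(u, v) = g_V(u i, v)` of `ℍ`, the imaginary part of the Hermitian
metric `h_V = g_V + i ω_V` (which is antilinear in the first variable). -/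
def omegaV : ℍ[ℝ] [⋀^Fin 2]→L[ℝ] ℝ where
  toFun v := inner ℝ (rightI (v 0)) (v 1)
  map_update_add' m i x y := by
    fin_cases i <;> simp [Function.update, inner_add_left, inner_add_right]
  map_update_smul' m i c x := by
    fin_cases i <;> simp [Function.update, inner_smul_left, inner_smul_right]
  cont := by fun_prop
  map_eq_zero_of_eq' v i j h hij := by
    fin_cases i <;> fin_cases j <;> simp at h hij ⊢
    · rw [h]; exact inner_rightI_self _
    · rw [h]; exact inner_rightI_self _

/-- The wedge product `α ∧ β` of two alternating `2`-forms on `ℍ`, evaluated on four vectors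
(sum over the `(2,2)`-shuffles). -/
def wedge (α β : ℍ[ℝ] [⋀^Fin 2]→L[ℝ] ℝ) (u : Fin 4 → ℍ[ℝ]) : ℝ :=
  α ![u 0, u 1] * β ![u 2, u 3] - α ![u 0, u 2] * β ![u 1, u 3] + α ![u 0, u 3] * β ![u 1, u 2]
    + α ![u 1, u 2] * β ![u 0, u 3] - α ![u 1, u 3] * β ![u 0, u 2] + α ![u 2, u 3] * β ![u 0, u 1]

/-- The volume form `σ_V = ω_V ∧ ω_V / 2`, evaluated on four vectors. -/
def volV (u : Fin 4 → ℍ[ℝ]) : ℝ := wedge omegaV omegaV u / 2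

/-- The inner product of `Λ² ℍ*` induced by `g_V`:
`g(α, β) = ∑_{a < b} α(e_a, e_b) β(e_a, e_b)` for the orthonormal frame `e`. -/
def innerTwo (α β : ℍ[ℝ] [⋀^Fin 2]→L[ℝ] ℝ) : ℝ :=
  ∑ a : Fin 4, ∑ b ∈ Finset.Ioi a, α ![frame a, frame b] * β ![frame a, frame b]

/-- `α' = * α` for the Hodge operator `*` of `Λ² ℍ*` given by the metric `g_V` and the orientation
of `ω_V`, that is `β ∧ * α = g(β, α) σ_V` for every `β`. This determines `α'` uniquely. -/
def IsHodgeStar (α α' : ℍ[ℝ] [⋀^Fin 2]→L[ℝ] ℝ) : Prop :=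
  ∀ (β : ℍ[ℝ] [⋀^Fin 2]→L[ℝ] ℝ) (u : Fin 4 → ℍ[ℝ]), wedge β α' u = innerTwo β α * volV u

/-! ### The torus `M = ℍ / Γ` as a smooth manifold -/

section Torus

variable (Γ : Submodule ℤ ℍ[ℝ])

/-- The torus `M = V / Γ`, with the quotient topology. -/
abbrev Torus : Type := ℍ[ℝ] ⧸ Γ.toAddSubgroup

/-- The covering projection `p : V → M`. -/
def proj (z : ℍ[ℝ]) : Torus Γ := QuotientAddGroup.mk z

theorem proj_surjective : Function.Surjective (proj Γ) := QuotientAddGroup.mk_surjective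

theorem proj_eq_iff {y z : ℍ[ℝ]} : proj Γ y = proj Γ z ↔ z - y ∈ Γ := by
  unfold proj
  rw [QuotientAddGroup.eq, neg_add_eq_sub]
  rfl

variable [DiscreteTopology Γ]

theorem isLocalHomeomorph_proj : IsLocalHomeomorph (proj Γ) :=
  (AddSubgroup.isAddQuotientCoveringMap_of_comm Γ.toAddSubgroup
    (by constructor; exact inferInstanceAs (DiscreteTopology Γ))).isCoveringMap.isLocalHomeomorph

/-- The smooth structure of `M`: the charts are the local inverses of the covering projection. -/
instance : ChartedSpace ℍ[ℝ] (Torus Γ) :=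
  (isLocalHomeomorph_proj Γ).chartedSpace (proj_surjective Γ)

variable {Γ}

theorem proj_chart {e : OpenPartialHomeomorph (Torus Γ) ℍ[ℝ]} (he : e ∈ atlas ℍ[ℝ] (Torus Γ)) :
    (e.symm : ℍ[ℝ] → Torus Γ) = proj Γ := by
  obtain ⟨q, rfl⟩ := he
  ext z
  simp only [OpenPartialHomeomorph.trans_symm_eq_symm_trans_symm, OpenPartialHomeomorph.coe_trans,
    IsLocalHomeomorph.localInverseAt_symm, chartAt_self_eq, OpenPartialHomeomorph.refl_symm,
    OpenPartialHomeomorph.refl_apply, Function.comp_apply, id_eq]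

/-- A chart composed with the covering projection is locally a translation. -/
theorem chart_proj {e : OpenPartialHomeomorph (Torus Γ) ℍ[ℝ]} (he : e ∈ atlas ℍ[ℝ] (Torus Γ))
    {z : ℍ[ℝ]} (hz : proj Γ z ∈ e.source) :
    ∃ c : ℍ[ℝ], (fun y => e (proj Γ y)) =ᶠ[𝓝 z] fun y => y + c := by
  have hcont : ContinuousAt (fun y => e (proj Γ y) - y) z :=
    ((e.continuousAt hz).comp (isLocalHomeomorph_proj Γ).continuous.continuousAt).sub
      continuousAt_id
  have hmem : ∀ y, proj Γ y ∈ e.source → e (proj Γ y) - y ∈ Γ := by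
    intro y hy
    rw [← proj_eq_iff, ← proj_chart he, e.left_inv (by rw [proj_chart he]; exact hy)]
  obtain ⟨U, hU, hU0⟩ : ∃ U ∈ 𝓝 (e (proj Γ z) - z), U ∩ (Γ : Set ℍ[ℝ]) = {e (proj Γ z) - z} := by
    have : IsDiscrete (Γ : Set ℍ[ℝ]) := ⟨inferInstanceAs (DiscreteTopology Γ)⟩
    exact nhds_inter_eq_singleton_of_mem_discrete this (hmem z hz)
  refine ⟨e (proj Γ z) - z, ?_⟩
  have h1 : ∀ᶠ y in 𝓝 z, proj Γ y ∈ e.source :=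
    (isLocalHomeomorph_proj Γ).continuous.continuousAt (e.open_source.mem_nhds hz)
  filter_upwards [hcont hU, h1] with y hy hy'
  have : e (proj Γ y) - y ∈ U ∩ (Γ : Set ℍ[ℝ]) := ⟨hy, hmem y hy'⟩
  rw [hU0, Set.mem_singleton_iff] at this
  rw [← this]
  abel

instance : IsManifold 𝓘(ℝ, ℍ[ℝ]) ∞ (Torus Γ) := by
  apply isManifold_of_contDiffOn
  intro e e' he he' z hz
  simp only [modelWithCornersSelf_coe, modelWithCornersSelf_coe_symm, Set.preimage_id,
    Set.range_id, Set.inter_univ, OpenPartialHomeomorph.trans_source, Set.mem_inter_iff,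
    Set.mem_preimage, proj_chart he] at hz
  obtain ⟨c, hc⟩ := chart_proj he' hz.2
  apply ContDiffAt.contDiffWithinAt
  have : (fun y : ℍ[ℝ] => y + c) =ᶠ[𝓝 z] (𝓘(ℝ, ℍ[ℝ]) ∘ e.symm ≫ₕ e' ∘ 𝓘(ℝ, ℍ[ℝ]).symm) := by
    filter_upwards [hc] with y hy
    simp [proj_chart he, hy]
  exact (contDiffAt_id.add contDiffAt_const).congr_of_eventuallyEq this.symm

theorem contMDiff_proj : ContMDiff 𝓘(ℝ, ℍ[ℝ]) 𝓘(ℝ, ℍ[ℝ]) ∞ (proj Γ) := by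
  intro z
  rw [contMDiffAt_iff_target]
  refine ⟨(isLocalHomeomorph_proj Γ).continuous.continuousAt, ?_⟩
  obtain ⟨c, hc⟩ := chart_proj (chart_mem_atlas ℍ[ℝ] (proj Γ z)) (mem_chart_source ℍ[ℝ] (proj Γ z))
  have : (fun y : ℍ[ℝ] => y + c) =ᶠ[𝓝 z] (extChartAt 𝓘(ℝ, ℍ[ℝ]) (proj Γ z) ∘ proj Γ) := by
    filter_upwards [hc] with y hy
    simp [hy]
  exact (contDiffAt_id.add contDiffAt_const).contMDiffAt.congr_of_eventuallyEq this.symm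

/-- The canonical trivialization `ρ : TM → V` of the tangent bundle. The tangent space at `x` is
expressed in a chart, and the charts are local inverses of the projection `p`, so `ρ` is the
identity in charts; `rho_mfderiv_proj` says that `ρ ∘ p_*` is the identity of `V`, which
characterizes `ρ`. -/
def rho (x : Torus Γ) : TangentSpace 𝓘(ℝ, ℍ[ℝ]) x ≃L[ℝ] ℍ[ℝ] :=
  ContinuousLinearEquiv.refl ℝ ℍ[ℝ]

theorem rho_mfderiv_proj (z v : ℍ[ℝ]) :
    rho (proj Γ z) (mfderiv 𝓘(ℝ, ℍ[ℝ]) 𝓘(ℝ, ℍ[ℝ]) (proj Γ) z v) = v := by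
  obtain ⟨c, hc⟩ := chart_proj (chart_mem_atlas ℍ[ℝ] (proj Γ z)) (mem_chart_source ℍ[ℝ] (proj Γ z))
  have hd : MDifferentiableAt 𝓘(ℝ, ℍ[ℝ]) 𝓘(ℝ, ℍ[ℝ]) (proj Γ) z :=
    (contMDiff_proj z).mdifferentiableAt (by simp)
  have : mfderiv 𝓘(ℝ, ℍ[ℝ]) 𝓘(ℝ, ℍ[ℝ]) (proj Γ) z = ContinuousLinearMap.id ℝ ℍ[ℝ] := by
    have h : writtenInExtChartAt 𝓘(ℝ, ℍ[ℝ]) 𝓘(ℝ, ℍ[ℝ]) z (proj Γ) =ᶠ[𝓝 z] fun y => y + c := by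
      filter_upwards [hc] with y hy
      exact hy
    have h' : HasFDerivAt (fun y : ℍ[ℝ] => y + c) (ContinuousLinearMap.id ℝ ℍ[ℝ]) z :=
      (hasFDerivAt_id z).add_const c
    exact HasMFDerivAt.mfderiv
      ⟨hd.continuousAt, (h'.congr_of_eventuallyEq h).hasFDerivWithinAt⟩
  rw [this]
  rfl

end Torus

/-! ### Differential forms on the torus -/

section Forms

variable (Γ : Submodule ℤ ℍ[ℝ]) [DiscreteTopology Γ]

/-- The space `𝓜` of smooth maps `f : M → M`. -/
abbrev SmoothMap : Type := C^∞⟮𝓘(ℝ, ℍ[ℝ]), Torus Γ; 𝓘(ℝ, ℍ[ℝ]), Torus Γ⟯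

/-- Real-valued `k`-forms on `M` (not necessarily continuous): an alternating form on each tangent
space. -/
abbrev Form (k : ℕ) : Type := ∀ x : Torus Γ, TangentSpace 𝓘(ℝ, ℍ[ℝ]) x [⋀^Fin k]→L[ℝ] ℝ

/-- `V`-valued `1`-forms on `M`. -/
abbrev VForm : Type := ∀ x : Torus Γ, TangentSpace 𝓘(ℝ, ℍ[ℝ]) x →L[ℝ] ℍ[ℝ]

variable {Γ}

/-- The pullback `p^* α` of a form by the covering projection `p : V → M`, a form on `V`. -/
def Form.lift {k : ℕ} (α : Form Γ k) : ℍ[ℝ] → ℍ[ℝ] [⋀^Fin k]→L[ℝ] ℝ := fun z =>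
  (α (proj Γ z)).compContinuousLinearMap (mfderiv 𝓘(ℝ, ℍ[ℝ]) 𝓘(ℝ, ℍ[ℝ]) (proj Γ) z)

/-- A form on `M` is smooth: its pullback by the surjective local diffeomorphism `p` is smooth. -/
def Form.IsSmooth {k : ℕ} (α : Form Γ k) : Prop := ContDiff ℝ ∞ α.lift

/-- `β = d α` on `M`. Since `p` is a surjective local diffeomorphism, this is equivalent to
`p^* β = d (p^* α)` on `V`. -/
def Form.IsExtDeriv {k : ℕ} (α : Form Γ k) (β : Form Γ (k + 1)) : Prop :=
  β.lift = extDeriv α.lift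

/-- `β` is exact: it is `d η` for a smooth form `η` on `M`. -/
def Form.IsExact {k : ℕ} (β : Form Γ (k + 1)) : Prop :=
  ∃ η : Form Γ k, η.IsSmooth ∧ η.IsExtDeriv β

/-- The pullback `f^* α` of a form by a map `f : M → M`. -/
def Form.pullback {k : ℕ} (f : Torus Γ → Torus Γ) (α : Form Γ k) : Form Γ k := fun x =>
  (α (f x)).compContinuousLinearMap (mfderiv 𝓘(ℝ, ℍ[ℝ]) 𝓘(ℝ, ℍ[ℝ]) f x)

/-- A `2`-form on `M` is self-dual, `* α = α`, for the metric `g_M = ρ^* g_V` and the orientation of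
`ω_M`: at each point it is the pullback by `ρ` of a form on `V` which is its own Hodge dual. -/
def Form.IsSelfDual (α : Form Γ 2) : Prop :=
  ∀ x, IsHodgeStar ((α x).compContinuousLinearMap (rho x).symm)
    ((α x).compContinuousLinearMap (rho x).symm)

/-- The codifferential `δ η = - ∑_a ι_{e_a} ∇_{e_a} η` of a form on the Euclidean space `V`. -/
def codiff {k : ℕ} (η : ℍ[ℝ] → ℍ[ℝ] [⋀^Fin (k + 1)]→L[ℝ] ℝ) (z : ℍ[ℝ]) :
    ℍ[ℝ] [⋀^Fin k]→L[ℝ] ℝ :=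
  -∑ a : Fin 4, (fderiv ℝ η z (frame a)).curryLeft (frame a)

/-- A smooth form on `M` (of positive degree) is harmonic: `(d δ + δ d) α = 0`. The Hodge Laplacian
of the flat metric `g_M` is computed on `V`, since `p` is a surjective local isometry. -/
def Form.IsHarmonic {k : ℕ} (α : Form Γ (k + 1)) : Prop :=
  α.IsSmooth ∧ ∀ z, extDeriv (codiff α.lift) z + codiff (extDeriv α.lift) z = 0

variable (Γ) in
/-- The Kähler form `ω_M = ρ^* ω_V`. -/
def omegaM : Form Γ 2 := fun x => omegaV.compContinuousLinearMap (rho x : _ →L[ℝ] ℍ[ℝ])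

/-! ### Symplectic diffeomorphisms and the moment map -/

/-- `f` is a symplectic diffeomorphism of `(M, ω_M)`. -/
def IsSymplecticDiffeo (f : SmoothMap Γ) : Prop :=
  (∃ Φ : Diffeomorph 𝓘(ℝ, ℍ[ℝ]) 𝓘(ℝ, ℍ[ℝ]) (Torus Γ) (Torus Γ) ∞, ∀ x, Φ x = f x) ∧
    (omegaM Γ).pullback f = omegaM Γ

/-- `f` is homotopic to a symplectic diffeomorphism of `(M, ω_M)`. -/
def IsHomotopicToSymplectic (f : SmoothMap Γ) : Prop :=
  ∃ g : SmoothMap Γ, IsSymplecticDiffeo g ∧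
    ContinuousMap.Homotopic (⟨f, f.contMDiff.continuous⟩ : C(Torus Γ, Torus Γ))
      ⟨g, g.contMDiff.continuous⟩

/-- `f^* [ω_M] = [ω_M]` in de Rham cohomology. -/
def PreservesClass (f : SmoothMap Γ) : Prop :=
  Form.IsExact (k := 1) ((omegaM Γ).pullback f - omegaM Γ)

/-- The differential `𝒟 f = ρ ∘ f_*` of a map `f : M → M`, a `V`-valued `1`-form on `M`. -/
def differential (f : Torus Γ → Torus Γ) : VForm Γ := fun x =>
  (rho (f x) : _ →L[ℝ] ℍ[ℝ]).comp (mfderiv 𝓘(ℝ, ℍ[ℝ]) 𝓘(ℝ, ℍ[ℝ]) f x)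

/-- The inner product of `T*_x M ⊗ V` induced by `g_M` and `g_V`. -/
def innerOne (x : Torus Γ) (F G : TangentSpace 𝓘(ℝ, ℍ[ℝ]) x →L[ℝ] ℍ[ℝ]) : ℝ :=
  ∑ a : Fin 4, inner ℝ (F ((rho x).symm (frame a))) (G ((rho x).symm (frame a)))

/-- The almost complex structure `F ↦ - F ∘ A_M` on `V`-valued `1`-forms induced by an almost complex
structure `A` of `V`, where `A_M` is the endomorphism of `TM` deduced from `A` through `ρ`. -/
def formStructure (A : ℍ[ℝ] →L[ℝ] ℍ[ℝ]) (F : VForm Γ) : VForm Γ := fun x =>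
  -(F x).comp (((rho x).symm : ℍ[ℝ] →L[ℝ] _).comp (A.comp (rho x : _ →L[ℝ] ℍ[ℝ])))

/-- The involution `ℛ F = i (A · F)`, where `i` multiplies the values. -/
def involution (A : ℍ[ℝ] →L[ℝ] ℍ[ℝ]) (F : VForm Γ) : VForm Γ := fun x =>
  rightI.comp (formStructure A F x)

/-- The moment map `μ(F) = - g(ℛ F, F) / 2` of the action of `C^∞(M, S¹)` on `V`-valued `1`-forms,
for the Kähler structure induced by the almost complex structure `A`. -/
def momentMap (A : ℍ[ℝ] →L[ℝ] ℍ[ℝ]) (F : VForm Γ) : Torus Γ → ℝ := fun x =>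
  -(1 / 2) * innerOne x (involution A F x) (F x)

/-- The hyperKähler moment map `𝛍 = (μ_I, μ_J, μ_K)`. -/
def hyperMomentMap (F : VForm Γ) : Fin 3 → Torus Γ → ℝ :=
  ![momentMap (leftMul qi) F, momentMap (leftMul qj) F, momentMap (leftMul qk) F]

end Forms

end

end HyperKahlerTorus

open HyperKahlerTorus

/-! Everything is done on the universal covering `ℍ`. A smooth `f : M → M` lifts to `F = A + u`,
with `A` linear and preserving `Γ` (the action of `f` on the fundamental group) and `u` periodic.
The lift of `f^* ω_M` is then `A^* ω_V` plus the differential of an explicit periodic `1`-form. By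
integration over a fundamental domain, a constant form with a periodic primitive is zero, so `f`
preserves the class of `ω_M` exactly when `A` is symplectic (`IsLiftWith.preservesClass_iff`). In
that case `A` has determinant `±1` in a basis of `Γ`, hence maps `Γ` onto itself and descends to a
symplectic diffeomorphism, joined to `f` by a straight-line homotopy. Conversely, homotopic maps
have the same `A`. This gives (1).

Pointwise, the components of the moment map contract `f^* ω_M` with the three anti-self-dual
directions given by left multiplication by `i, j, k`, so they vanish exactly when `f^* ω_M` is
self-dual. A closed self-dual form is coclosed, hence harmonic. This gives (3).

If `dη` is self-dual with `η` periodic, coclosedness makes `|dη|²` the divergence of a periodic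
vector field, so its integral is zero and `dη = 0`. This is (4). Applied to `f^* ω_M - ω_M`, it
turns the moment map equation into `f^* ω_M = ω_M`. Then `F` is a local diffeomorphism at bounded
distance from the invertible map `A`, hence proper, hence a diffeomorphism of the simply connected
space `ℍ`. Its inverse descends to `M`, which gives (2). -/

/-! ### Integration of periodic functions over a lattice -/

section Periodic

open MeasureTheory
open scoped Pointwise

variable {E : Type*} [NormedAddCommGroup E] [NormedSpace ℝ E] [FiniteDimensional ℝ E]
  (L : Submodule ℤ E) [DiscreteTopology L] [IsZLattice ℝ L]

include L in
theorem exists_norm_le_of_periodic {F : Type*} [SeminormedAddCommGroup F] {f : E → F}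
    (hf : Continuous f) (hper : ∀ z, ∀ w ∈ L, f (z + w) = f z) : ∃ C, ∀ z, ‖f z‖ ≤ C := by
  obtain ⟨C, hC⟩ :=
    (IsZLattice.isCompact_range_of_periodic L f hf fun z w hw => hper z w hw).isBounded.exists_norm_le
  exact ⟨C, fun z => hC _ ⟨z, rfl⟩⟩

omit [FiniteDimensional ℝ E] [DiscreteTopology L] [IsZLattice ℝ L] in
theorem fderiv_periodic {F : Type*} [NormedAddCommGroup F] [NormedSpace ℝ F] {f : E → F} {w : E}
    (hper : ∀ z, f (z + w) = f z) (z : E) : fderiv ℝ f (z + w) = fderiv ℝ f z := by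
  rw [← fderiv_comp_add_right]
  simp only [hper]

omit [NormedSpace ℝ E] [FiniteDimensional ℝ E] [DiscreteTopology L] [IsZLattice ℝ L] in
theorem vaddInvariantMeasure_submodule [MeasurableSpace E] [BorelSpace E] (μ : Measure E)
    [μ.IsAddLeftInvariant] : VAddInvariantMeasure L E μ :=
  ⟨fun c s _ => measure_preimage_add μ (c : E) s⟩

/-- The integral over a fundamental domain of a directional derivative of a periodic function
vanishes. -/
theorem setIntegral_fderiv_periodic_eq_zero [MeasurableSpace E] [BorelSpace E] (μ : Measure E)
    [μ.IsAddHaarMeasure] {ι : Type*} [Finite ι] (b : Module.Basis ι ℤ L) {h : E → ℝ}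
    (hh : ContDiff ℝ 1 h) (hper : ∀ z, ∀ w ∈ L, h (z + w) = h z) (v : E) :
    ∫ z in ZSpan.fundamentalDomain (b.ofZLatticeBasis ℝ L), fderiv ℝ h z v ∂μ = 0 := by
  set D := ZSpan.fundamentalDomain (b.ofZLatticeBasis ℝ L) with hD
  have hdom : IsAddFundamentalDomain L D μ := ZLattice.isAddFundamentalDomain b μ
  have := vaddInvariantMeasure_submodule L μ
  have hfin : μ D < ⊤ := (ZSpan.fundamentalDomain_isBounded _).measure_lt_top
  have : IsFiniteMeasure (μ.restrict D) := ⟨by simpa using hfin⟩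
  have hcont := hh.continuous
  have hcont' : Continuous fun z => fderiv ℝ h z v :=
    (hh.continuous_fderiv one_ne_zero).clm_apply continuous_const
  obtain ⟨C, hC⟩ := exists_norm_le_of_periodic L hcont hper
  obtain ⟨C', hC'⟩ := exists_norm_le_of_periodic L hcont' fun z w hw => by
    rw [fderiv_periodic fun z => hper z w hw]
  -- A translate of a fundamental domain is again one, so the integral of `h (z + t v)` does not
  -- depend on `t`. Differentiating under the integral sign at `t = 0` gives the claim; periodicity
  -- bounds the derivative uniformly.
  have hconst : ∀ t : ℝ, ∫ z in D, h (z + t • v) ∂μ = ∫ z in D, h z ∂μ := by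
    intro t
    have h1 : IsAddFundamentalDomain L ((t • v) +ᵥ D) μ := hdom.vadd_of_comm (t • v)
    have h2 := hdom.setIntegral_eq h1 (f := h) fun g x => by
      rw [Submodule.vadd_def, vadd_eq_add, add_comm, hper x g g.2]
    rw [h2]
    have h3 : (fun z => z + t • v) ⁻¹' ((t • v) +ᵥ D) = D := by
      ext z
      rw [Set.mem_preimage, Set.mem_vadd_set_iff_neg_vadd_mem, vadd_eq_add]
      simp
    have h4 := (measurePreserving_add_right μ (t • v)).setIntegral_preimage_emb
      (measurableEmbedding_addRight _) h ((t • v) +ᵥ D)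
    rw [h3] at h4
    exact h4
  have hder := (hasDerivAt_integral_of_dominated_loc_of_deriv_le (μ := μ.restrict D) (x₀ := (0 : ℝ))
    (F := fun t z => h (z + t • v)) (F' := fun t z => fderiv ℝ h (z + t • v) v) (s := Set.univ)
    (bound := fun _ => C') Filter.univ_mem
    (.of_forall fun t => (hcont.comp (by fun_prop)).aestronglyMeasurable)
    (by
      refine Integrable.of_bound (hcont.comp (by fun_prop)).aestronglyMeasurable C ?_
      exact .of_forall fun z => hC _)
    (hcont'.comp (by fun_prop : Continuous fun z : E => z + (0 : ℝ) • v)).aestronglyMeasurable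
    (.of_forall fun z t _ => hC' _) (integrable_const _)
    (.of_forall fun z t _ => by
      have h1 : HasFDerivAt h (fderiv ℝ h (z + t • v)) (z + t • v) :=
        (hh.differentiable one_ne_zero _).hasFDerivAt
      have h2 : HasDerivAt (fun t : ℝ => z + t • v) v t := by
        simpa using ((hasDerivAt_id t).smul_const v).const_add z
      exact h1.comp_hasDerivAt t h2)).2
  simp only [hconst, zero_smul, add_zero] at hder
  exact hder.unique (hasDerivAt_const _ _)

/-- A nonnegative function which is a sum of directional derivatives of periodic functions
vanishes. -/
theorem eq_zero_of_eq_sum_fderiv_periodic {ι : Type*} (s : Finset ι) {h : ι → E → ℝ} {v : ι → E}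
    {φ : E → ℝ} (hh : ∀ i ∈ s, ContDiff ℝ 1 (h i))
    (hper : ∀ i ∈ s, ∀ z, ∀ w ∈ L, h i (z + w) = h i z)
    (hφ : ∀ z, φ z = ∑ i ∈ s, fderiv ℝ (h i) z (v i)) (hpos : ∀ z, 0 ≤ φ z) (z : E) : φ z = 0 := by
  borelize E
  let μ : Measure E := Measure.addHaar
  have := ZLattice.module_free ℝ L
  let b := Module.Free.chooseBasis ℤ L
  set D := ZSpan.fundamentalDomain (b.ofZLatticeBasis ℝ L) with hD
  have hdom : IsAddFundamentalDomain L D μ := ZLattice.isAddFundamentalDomain b μ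
  have := vaddInvariantMeasure_submodule L μ
  have hfin : μ D < ⊤ := (ZSpan.fundamentalDomain_isBounded _).measure_lt_top
  have : IsFiniteMeasure (μ.restrict D) := ⟨by simpa using hfin⟩
  have hc : ∀ i ∈ s, Continuous fun z => fderiv ℝ (h i) z (v i) := fun i hi =>
    ((hh i hi).continuous_fderiv one_ne_zero).clm_apply continuous_const
  have hperd : ∀ i ∈ s, ∀ z, ∀ w ∈ L, fderiv ℝ (h i) (z + w) (v i) = fderiv ℝ (h i) z (v i) := by
    intro i hi z w hw
    rw [fderiv_periodic fun z => hper i hi z w hw]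
  have hint : ∀ i ∈ s, Integrable (fun z => fderiv ℝ (h i) z (v i)) (μ.restrict D) := by
    intro i hi
    obtain ⟨C, hC⟩ := exists_norm_le_of_periodic L (hc i hi) (hperd i hi)
    exact Integrable.of_bound (hc i hi).aestronglyMeasurable C (.of_forall hC)
  have hφc : Continuous φ := by
    rw [funext hφ]
    exact continuous_finsetSum s hc
  have hφper : ∀ z, ∀ w ∈ L, φ (z + w) = φ z := by
    intro z w hw
    rw [hφ, hφ]
    exact Finset.sum_congr rfl fun i hi => hperd i hi z w hw
  have hzero : ∫ z in D, φ z ∂μ = 0 := by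
    rw [funext hφ, integral_finsetSum s hint]
    exact Finset.sum_eq_zero fun i hi =>
      setIntegral_fderiv_periodic_eq_zero L μ b (hh i hi) (hper i hi) (v i)
  have hφint : Integrable φ (μ.restrict D) := by
    rw [funext hφ]
    exact integrable_finsetSum s hint
  have hae : φ =ᵐ[μ.restrict D] 0 := (integral_eq_zero_iff_of_nonneg hpos hφint).1 hzero
  -- Vanishing almost everywhere on one fundamental domain spreads to `E` by periodicity, and then
  -- to every point by continuity.
  have hae' : φ =ᵐ[μ] 0 := by
    have h0 : μ (D ∩ {z | φ z ≠ 0}) = 0 := by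
      have h1 : (μ.restrict D) {z | φ z ≠ 0} = 0 := hae
      rwa [Measure.restrict_apply (isOpen_ne_fun hφc continuous_const).measurableSet,
        Set.inter_comm] at h1
    refine (hdom.measure_zero_of_invariant {z | φ z ≠ 0} ?_ ?_ : μ {z | φ z ≠ 0} = 0)
    · intro g
      ext x
      rw [Set.mem_vadd_set_iff_neg_vadd_mem, Submodule.vadd_def, vadd_eq_add, add_comm]
      simp only [Set.mem_ofPred_eq]
      rw [hφper x _ (-g).2]
    · rwa [Set.inter_comm] 
  exact congrFun ((hφc.ae_eq_iff_eq μ continuous_zero).1 hae') z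

end Periodic

namespace HyperKahlerTorus

/-! ### Self-duality of alternating `2`-forms on `ℍ` -/

theorem omegaV_apply (u v : ℍ[ℝ]) : omegaV ![u, v] =
    -u.imI * v.re + u.re * v.imI + u.imK * v.imJ - u.imJ * v.imK := by
  change inner ℝ (u * qi) v = _
  have h0 : qi.re = 0 := rfl
  have h1 : qi.imI = 1 := rfl
  have h2 : qi.imJ = 0 := rfl
  have h3 : qi.imK = 0 := rfl
  simp only [Quaternion.inner_def, Quaternion.re_mul, Quaternion.imI_mul, Quaternion.imJ_mul,
    Quaternion.imK_mul, Quaternion.re_star, Quaternion.imI_star, Quaternion.imJ_star,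
    Quaternion.imK_star, h0, h1, h2, h3]
  ring

@[simp] theorem re_frame (a : Fin 4) : (frame a).re = if a = 0 then 1 else 0 := by
  fin_cases a <;> rfl

@[simp] theorem imI_frame (a : Fin 4) : (frame a).imI = if a = 1 then 1 else 0 := by
  fin_cases a <;> rfl

@[simp] theorem imJ_frame (a : Fin 4) : (frame a).imJ = if a = 2 then 1 else 0 := by
  fin_cases a <;> rfl

@[simp] theorem imK_frame (a : Fin 4) : (frame a).imK = if a = 3 then 1 else 0 := by
  fin_cases a <;> rfl

theorem eq_sum_frame (u : ℍ[ℝ]) :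
    u = u.re • frame 0 + u.imI • frame 1 + u.imJ • frame 2 + u.imK • frame 3 := by
  ext <;> simp

section Alternating

variable (α : ℍ[ℝ] [⋀^Fin 2]→L[ℝ] ℝ)

theorem two_form_add_left (u u' v : ℍ[ℝ]) : α ![u + u', v] = α ![u, v] + α ![u', v] :=
  α.toMultilinearMap.cons_add ![v] u u'

theorem two_form_smul_left (c : ℝ) (u v : ℍ[ℝ]) : α ![c • u, v] = c * α ![u, v] :=
  α.toMultilinearMap.cons_smul ![v] c u

theorem two_form_swap (u v : ℍ[ℝ]) : α ![u, v] = -α ![v, u] := by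
  have h := α.toAlternatingMap.map_swap ![v, u] (i := 0) (j := 1) (by decide)
  have h' : ![v, u] ∘ Equiv.swap (0 : Fin 2) 1 = ![u, v] := by
    funext i; fin_cases i <;> rfl
  rw [h'] at h
  exact h

theorem two_form_self (u : ℍ[ℝ]) : α ![u, u] = 0 :=
  α.map_eq_zero_of_eq _ (i := 0) (j := 1) rfl (by decide)

theorem two_form_neg_left (u v : ℍ[ℝ]) : α ![-u, v] = -α ![u, v] := by
  simpa using two_form_smul_left α (-1) u v

/-- Expansion in the Plücker coordinates of `u ∧ v`. It reduces identities between `2`-forms to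
polynomial identities in coordinates. -/
theorem two_form_apply (u v : ℍ[ℝ]) : α ![u, v] =
    α ![frame 0, frame 1] * (u.re * v.imI - u.imI * v.re)
    + α ![frame 0, frame 2] * (u.re * v.imJ - u.imJ * v.re)
    + α ![frame 0, frame 3] * (u.re * v.imK - u.imK * v.re)
    + α ![frame 1, frame 2] * (u.imI * v.imJ - u.imJ * v.imI)
    + α ![frame 1, frame 3] * (u.imI * v.imK - u.imK * v.imI)
    + α ![frame 2, frame 3] * (u.imJ * v.imK - u.imK * v.imJ) := by
  have hl : ∀ w : ℍ[ℝ], α ![u, w] = u.re * α ![frame 0, w] + u.imI * α ![frame 1, w]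
      + u.imJ * α ![frame 2, w] + u.imK * α ![frame 3, w] := by
    intro w
    conv_lhs => rw [eq_sum_frame u]
    simp only [two_form_add_left, two_form_smul_left]
  have hr : ∀ w : ℍ[ℝ], α ![w, v] = v.re * α ![w, frame 0] + v.imI * α ![w, frame 1]
      + v.imJ * α ![w, frame 2] + v.imK * α ![w, frame 3] := by
    intro w
    rw [two_form_swap]
    conv_lhs => rw [eq_sum_frame v]
    simp only [two_form_add_left, two_form_smul_left]
    rw [two_form_swap α w (frame 0), two_form_swap α w (frame 1), two_form_swap α w (frame 2),
      two_form_swap α w (frame 3)]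
    ring
  rw [hl, hr, hr (frame 1), hr (frame 2), hr (frame 3)]
  simp only [two_form_self]
  rw [two_form_swap α (frame 1) (frame 0), two_form_swap α (frame 2) (frame 0),
    two_form_swap α (frame 3) (frame 0), two_form_swap α (frame 2) (frame 1),
    two_form_swap α (frame 3) (frame 1), two_form_swap α (frame 3) (frame 2)]
  ring

theorem two_form_eq_zero (h : ∀ a b, α ![frame a, frame b] = 0) : α = 0 := by
  ext v
  have hv : v = ![v 0, v 1] := by funext i; fin_cases i <;> rfl
  rw [hv, two_form_apply]
  simp [h]

/-- The linear equations of self-dual `2`-forms in the frame `1, i, j, k`. -/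
def SelfDualEq : Prop :=
  α ![frame 0, frame 1] + α ![frame 2, frame 3] = 0 ∧
  α ![frame 0, frame 2] - α ![frame 1, frame 3] = 0 ∧
  α ![frame 0, frame 3] + α ![frame 1, frame 2] = 0

theorem innerTwo_apply (β : ℍ[ℝ] [⋀^Fin 2]→L[ℝ] ℝ) : innerTwo α β =
    α ![frame 0, frame 1] * β ![frame 0, frame 1] + α ![frame 0, frame 2] * β ![frame 0, frame 2]
    + α ![frame 0, frame 3] * β ![frame 0, frame 3] + α ![frame 1, frame 2] * β ![frame 1, frame 2]
    + α ![frame 1, frame 3] * β ![frame 1, frame 3]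
    + α ![frame 2, frame 3] * β ![frame 2, frame 3] := by
  have h0 : Finset.Ioi (0 : Fin 4) = {1, 2, 3} := rfl
  have h1 : Finset.Ioi (1 : Fin 4) = {2, 3} := rfl
  have h2 : Finset.Ioi (2 : Fin 4) = {3} := rfl
  have h3 : Finset.Ioi (3 : Fin 4) = ∅ := rfl
  simp [innerTwo, Fin.sum_univ_four, h0, h1, h2, h3]
  ring

/-- The wedge product `x ∧ y` of two linear forms. -/
noncomputable def wedgeOne (x y : ℍ[ℝ] →L[ℝ] ℝ) : ℍ[ℝ] [⋀^Fin 2]→L[ℝ] ℝ where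
  toFun v := x (v 0) * y (v 1) - x (v 1) * y (v 0)
  map_update_add' m i u v := by
    fin_cases i <;> simp [Function.update] <;> ring
  map_update_smul' m i c u := by
    fin_cases i <;> simp [Function.update] <;> ring
  cont := by fun_prop
  map_eq_zero_of_eq' v i j h hij := by
    fin_cases i <;> fin_cases j <;> simp at h hij ⊢ <;> rw [h] <;> ring

theorem wedgeOne_apply (x y : ℍ[ℝ] →L[ℝ] ℝ) (u v : ℍ[ℝ]) :
    wedgeOne x y ![u, v] = x u * y v - x v * y u := rfl

theorem inner_frame (a b : Fin 4) : inner ℝ (frame a) (frame b) = if a = b then (1 : ℝ) else 0 := by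
  simp only [Quaternion.inner_def, Quaternion.re_mul, Quaternion.re_star, Quaternion.imI_star,
    Quaternion.imJ_star, Quaternion.imK_star, re_frame, imI_frame, imJ_frame, imK_frame]
  fin_cases a <;> fin_cases b <;> simp

/-- The frame `1, i, j, k` is negative for the orientation of `ω_V ∧ ω_V`, because the complex
structure is multiplication on the right. This is why the signs in `SelfDualEq` are opposite to the
usual ones. -/
theorem volV_frame : volV frame = -1 := by
  simp only [volV, wedge, omegaV_apply]
  simp

theorem SelfDualEq.isHodgeStar {α : ℍ[ℝ] [⋀^Fin 2]→L[ℝ] ℝ} (h : SelfDualEq α) :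
    IsHodgeStar α α := by
  intro β u
  obtain ⟨h1, h2, h3⟩ := h
  replace h1 : α ![frame 2, frame 3] = -α ![frame 0, frame 1] := by linarith
  replace h2 : α ![frame 1, frame 3] = α ![frame 0, frame 2] := by linarith
  replace h3 : α ![frame 1, frame 2] = -α ![frame 0, frame 3] := by linarith
  rw [innerTwo_apply]
  simp only [volV, wedge, omegaV_apply, two_form_apply α (u _) (u _),
    two_form_apply β (u _) (u _)]
  rw [h1, h2, h3]
  ring

theorem isHodgeStar_self_iff : IsHodgeStar α α ↔ SelfDualEq α := by
  refine ⟨fun h => ?_, SelfDualEq.isHodgeStar⟩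
  -- Testing the Hodge identity against `e^0 ∧ e^b` on the frame itself isolates one of the three
  -- equations for each `b`.
  have key : ∀ a b : Fin 4, wedge (wedgeOne (innerSL ℝ (frame a)) (innerSL ℝ (frame b))) α frame =
      innerTwo (wedgeOne (innerSL ℝ (frame a)) (innerSL ℝ (frame b))) α * volV frame :=
    fun a b => h _ _
  refine ⟨?_, ?_, ?_⟩
  · have := key 0 1
    simp only [wedge, innerTwo_apply, wedgeOne_apply, innerSL_apply_apply, inner_frame, volV_frame]
      at this
    simp at this
    linarith
  · have := key 0 2
    simp only [wedge, innerTwo_apply, wedgeOne_apply, innerSL_apply_apply, inner_frame, volV_frame]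
      at this
    simp at this
    linarith
  · have := key 0 3
    simp only [wedge, innerTwo_apply, wedgeOne_apply, innerSL_apply_apply, inner_frame, volV_frame]
      at this
    simp at this
    linarith

theorem selfDualEq_omegaV : SelfDualEq omegaV := by
  simp only [SelfDualEq, omegaV_apply]
  simp

theorem SelfDualEq.sub {α β : ℍ[ℝ] [⋀^Fin 2]→L[ℝ] ℝ} (hα : SelfDualEq α) (hβ : SelfDualEq β) :
    SelfDualEq (α - β) := by
  obtain ⟨h1, h2, h3⟩ := hα
  obtain ⟨g1, g2, g3⟩ := hβ
  simp only [SelfDualEq, ContinuousAlternatingMap.sub_apply]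
  exact ⟨by linarith, by linarith, by linarith⟩

end Alternating

/-! ### The moment map at a point -/

theorem leftMul_frame :
    leftMul qi (frame 0) = frame 1 ∧ leftMul qi (frame 1) = -frame 0 ∧
    leftMul qi (frame 2) = frame 3 ∧ leftMul qi (frame 3) = -frame 2 ∧
    leftMul qj (frame 0) = frame 2 ∧ leftMul qj (frame 1) = -frame 3 ∧
    leftMul qj (frame 2) = -frame 0 ∧ leftMul qj (frame 3) = frame 1 ∧
    leftMul qk (frame 0) = frame 3 ∧ leftMul qk (frame 1) = frame 2 ∧
    leftMul qk (frame 2) = -frame 1 ∧ leftMul qk (frame 3) = -frame 0 := by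
  have h : ∀ q v : ℍ[ℝ], leftMul q v = q * v := fun _ _ => rfl
  have hi : qi = frame 1 := rfl
  have hj : qj = frame 2 := rfl
  have hk : qk = frame 3 := rfl
  simp only [h, hi, hj, hk]
  refine ⟨?_, ?_, ?_, ?_, ?_, ?_, ?_, ?_, ?_, ?_, ?_, ?_⟩ <;>
    ext <;> simp [Quaternion.re_mul, Quaternion.imI_mul, Quaternion.imJ_mul, Quaternion.imK_mul]

/-- The pullback of `ω_V` by a linear map. -/
noncomputable def pullOmega (B : ℍ[ℝ] →L[ℝ] ℍ[ℝ]) : ℍ[ℝ] [⋀^Fin 2]→L[ℝ] ℝ :=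
  omegaV.compContinuousLinearMap B

theorem pullOmega_apply (B : ℍ[ℝ] →L[ℝ] ℍ[ℝ]) (u v : ℍ[ℝ]) :
    pullOmega B ![u, v] = inner ℝ (rightI (B u)) (B v) := rfl

/-- By the multiplication table, each sum is `-2` times the left-hand side of one of the equations
in `SelfDualEq`. Left multiplications by `i, j, k` span the anti-self-dual directions, so this is
orthogonality to them. -/
theorem sum_pullOmega_eq_zero_iff (B : ℍ[ℝ] →L[ℝ] ℍ[ℝ]) :
    (∑ a, pullOmega B ![leftMul qi (frame a), frame a] = 0 ∧
      ∑ a, pullOmega B ![leftMul qj (frame a), frame a] = 0 ∧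
      ∑ a, pullOmega B ![leftMul qk (frame a), frame a] = 0) ↔ SelfDualEq (pullOmega B) := by
  obtain ⟨h1, h2, h3, h4, h5, h6, h7, h8, h9, h10, h11, h12⟩ := leftMul_frame
  simp only [Fin.sum_univ_four, h1, h2, h3, h4, h5, h6, h7, h8, h9, h10, h11, h12,
    two_form_neg_left, SelfDualEq]
  rw [two_form_swap _ (frame 1) (frame 0), two_form_swap _ (frame 3) (frame 2),
    two_form_swap _ (frame 2) (frame 0), two_form_swap _ (frame 3) (frame 1),
    two_form_swap _ (frame 3) (frame 0), two_form_swap _ (frame 2) (frame 1)]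
  constructor <;> rintro ⟨g1, g2, g3⟩ <;> refine ⟨?_, ?_, ?_⟩ <;> linarith

/-! ### Forms and maps on the torus and their lifts -/

section Lifts

variable {Γ : Submodule ℤ ℍ[ℝ]} [DiscreteTopology Γ]

omit [DiscreteTopology Γ] in
theorem proj_add_of_mem (z : ℍ[ℝ]) {w : ℍ[ℝ]} (hw : w ∈ Γ) : proj Γ (z + w) = proj Γ z :=
  (proj_eq_iff Γ).2 (by simpa using hw)

theorem mfderiv_proj (z : ℍ[ℝ]) : mfderiv 𝓘(ℝ, ℍ[ℝ]) 𝓘(ℝ, ℍ[ℝ]) (proj Γ) z =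
    ((rho (proj Γ z)).symm : ℍ[ℝ] →L[ℝ] _) := by
  exact ContinuousLinearMap.ext fun v => rho_mfderiv_proj z v

namespace Form

variable {k : ℕ}

theorem lift_eq (α : Form Γ k) (z : ℍ[ℝ]) : α.lift z =
    (α (proj Γ z)).compContinuousLinearMap ((rho (proj Γ z)).symm : ℍ[ℝ] →L[ℝ] _) := by
  rw [Form.lift, mfderiv_proj]

theorem lift_add_of_mem (α : Form Γ k) (z : ℍ[ℝ]) {w : ℍ[ℝ]} (hw : w ∈ Γ) :
    α.lift (z + w) = α.lift z := by
  rw [lift_eq, lift_eq, proj_add_of_mem z hw]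

theorem ext_lift {α β : Form Γ k} (h : ∀ z, α.lift z = β.lift z) : α = β := by
  funext x
  obtain ⟨z, rfl⟩ := proj_surjective Γ x
  have := h z
  rw [lift_eq, lift_eq] at this
  exact this

theorem lift_sub (α β : Form Γ k) (z : ℍ[ℝ]) : (α - β).lift z = α.lift z - β.lift z := rfl

/-- A periodic form on `ℍ` is the lift of a form on the torus. -/
theorem exists_lift_eq {e : ℍ[ℝ] → ℍ[ℝ] [⋀^Fin k]→L[ℝ] ℝ}
    (he : ∀ z, ∀ w ∈ Γ, e (z + w) = e z) : ∃ α : Form Γ k, α.lift = e := by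
  refine ⟨fun x => (e (Function.surjInv (proj_surjective Γ) x)).compContinuousLinearMap
    (rho x : _ →L[ℝ] ℍ[ℝ]), ?_⟩
  funext z
  rw [lift_eq]
  have h1 := Function.surjInv_eq (proj_surjective Γ) (proj Γ z)
  have h2 := he (Function.surjInv (proj_surjective Γ) (proj Γ z)) _ ((proj_eq_iff Γ).1 h1)
  rw [add_sub_cancel] at h2
  rw [h2]
  rfl

theorem isSelfDual_iff (α : Form Γ 2) : α.IsSelfDual ↔ ∀ z, SelfDualEq (α.lift z) := by
  constructor
  · intro h z
    rw [lift_eq]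
    exact (isHodgeStar_self_iff _).1 (h (proj Γ z))
  · intro h x
    obtain ⟨z, rfl⟩ := proj_surjective Γ x
    have := h z
    rw [lift_eq] at this
    exact (isHodgeStar_self_iff _).2 this

theorem lift_omegaM (z : ℍ[ℝ]) : (omegaM Γ).lift z = omegaV := by
  rw [lift_eq]
  rfl

end Form

variable (Γ) in
theorem isCoveringMap_proj : IsCoveringMap (proj Γ) :=
  (AddSubgroup.isAddQuotientCoveringMap_of_comm Γ.toAddSubgroup
    (by constructor; exact inferInstanceAs (DiscreteTopology Γ))).isCoveringMap

/-- `F` is a smooth lift of `f` to the universal covering. -/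
structure IsSmoothLift (f : Torus Γ → Torus Γ) (F : ℍ[ℝ] → ℍ[ℝ]) : Prop where
  contDiff : ContDiff ℝ ∞ F
  proj_apply : ∀ z, proj Γ (F z) = f (proj Γ z)

/-- Charts composed with `proj` are local translations, so a continuous lift agrees locally with `f
∘ proj` read in a chart, up to a constant. -/
theorem IsSmoothLift.of_continuous (f : SmoothMap Γ) {F : ℍ[ℝ] → ℍ[ℝ]} (hF : Continuous F)
    (h : ∀ z, proj Γ (F z) = f (proj Γ z)) : IsSmoothLift f F := by
  refine ⟨contDiff_iff_contDiffAt.2 fun z => ?_, h⟩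
  have hs : proj Γ (F z) ∈ (chartAt ℍ[ℝ] (f (proj Γ z))).source := by
    rw [h]
    exact mem_chart_source ℍ[ℝ] _
  obtain ⟨c, hc⟩ := chart_proj (chart_mem_atlas ℍ[ℝ] (f (proj Γ z))) hs
  have h1 : ContMDiffAt 𝓘(ℝ, ℍ[ℝ]) 𝓘(ℝ, ℍ[ℝ]) ∞
      (fun y => chartAt ℍ[ℝ] (f (proj Γ z)) (f (proj Γ y))) z := by
    have hch : ContMDiffAt 𝓘(ℝ, ℍ[ℝ]) 𝓘(ℝ, ℍ[ℝ]) ∞ (chartAt ℍ[ℝ] (f (proj Γ z)))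
        (f (proj Γ z)) :=
      contMDiffOn_chart.contMDiffAt ((chartAt ℍ[ℝ] _).open_source.mem_nhds (mem_chart_source ℍ[ℝ] _))
    exact ContMDiffAt.comp z hch ((f.contMDiff _).comp z (contMDiff_proj z))
  refine (h1.contDiffAt.sub (contDiffAt_const (c := c))).congr_of_eventuallyEq ?_
  filter_upwards [hF.continuousAt hc] with y hy
  have hy' : chartAt ℍ[ℝ] (f (proj Γ z)) (proj Γ (F y)) = F y + c := hy
  rw [← h y, hy', add_sub_cancel_right]

theorem exists_isSmoothLift (f : SmoothMap Γ) : ∃ F, IsSmoothLift f F := by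
  obtain ⟨w, hw⟩ := proj_surjective Γ (f (proj Γ 0))
  obtain ⟨F, ⟨-, hF⟩, -⟩ := (isCoveringMap_proj Γ).existsUnique_continuousMap_lifts
    (⟨fun z => f (proj Γ z), f.contMDiff.continuous.comp contMDiff_proj.continuous⟩ :
      C(ℍ[ℝ], Torus Γ)) 0 w hw
  exact ⟨F, .of_continuous f F.continuous fun z => congrFun hF z⟩

/-- A smooth map of `ℍ` compatible with the lattice descends to the torus. -/
theorem exists_smoothMap_of_lift {F : ℍ[ℝ] → ℍ[ℝ]} (hF : ContDiff ℝ ∞ F)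
    (h : ∀ z, ∀ w ∈ Γ, F (z + w) - F z ∈ Γ) : ∃ f : SmoothMap Γ, IsSmoothLift f F := by
  let s := Function.surjInv (proj_surjective Γ)
  have hs : ∀ z, proj Γ (F (s (proj Γ z))) = proj Γ (F z) := by
    intro z
    have h1 := Function.surjInv_eq (proj_surjective Γ) (proj Γ z)
    have h2 := h (Function.surjInv (proj_surjective Γ) (proj Γ z)) _ ((proj_eq_iff Γ).1 h1)
    rw [add_sub_cancel] at h2
    exact (proj_eq_iff Γ).2 h2
  refine ⟨⟨fun x => proj Γ (F (s x)), fun x => ?_⟩, hF, fun z => (hs z).symm⟩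
  let e := chartAt ℍ[ℝ] x
  have he : ContMDiffAt 𝓘(ℝ, ℍ[ℝ]) 𝓘(ℝ, ℍ[ℝ]) ∞ e x :=
    contMDiffOn_chart.contMDiffAt (e.open_source.mem_nhds (mem_chart_source ℍ[ℝ] x))
  -- Near `x` the chart is a right inverse of `proj`, so the descended map is locally `proj ∘ F ∘
  -- e`.
  have hcomp : ContMDiffAt 𝓘(ℝ, ℍ[ℝ]) 𝓘(ℝ, ℍ[ℝ]) ∞ (fun y => proj Γ (F (e y))) x :=
    ContMDiffAt.comp x (contMDiff_proj _) (ContMDiffAt.comp x (hF.contMDiff _) he)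
  refine hcomp.congr_of_eventuallyEq ?_
  filter_upwards [e.open_source.mem_nhds (mem_chart_source ℍ[ℝ] x)] with y hy
  have h3 : proj Γ (e y) = y := by
    rw [← proj_chart (chart_mem_atlas ℍ[ℝ] x)]
    exact e.left_inv hy
  have h4 := hs (e y)
  rwa [h3] at h4

namespace IsSmoothLift

variable {f : SmoothMap Γ} {F : ℍ[ℝ] → ℍ[ℝ]}

/-- The chain rule for `f ∘ proj = proj ∘ F`, where `proj` has trivial differential once tangent
spaces are identified through `rho`. -/
theorem mfderiv_comp_eq (h : IsSmoothLift f F) (z : ℍ[ℝ]) :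
    (rho (f (proj Γ z)) : _ →L[ℝ] ℍ[ℝ]).comp
      ((mfderiv 𝓘(ℝ, ℍ[ℝ]) 𝓘(ℝ, ℍ[ℝ]) f (proj Γ z)).comp
        ((rho (proj Γ z)).symm : ℍ[ℝ] →L[ℝ] _)) = fderiv ℝ F z := by
  have hp : ∀ y, MDifferentiableAt 𝓘(ℝ, ℍ[ℝ]) 𝓘(ℝ, ℍ[ℝ]) (proj Γ) y := fun y =>
    (contMDiff_proj y).mdifferentiableAt (by simp)
  have hf : MDifferentiableAt 𝓘(ℝ, ℍ[ℝ]) 𝓘(ℝ, ℍ[ℝ]) f (proj Γ z) :=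
    (f.contMDiff _).mdifferentiableAt (by simp)
  have hF : MDifferentiableAt 𝓘(ℝ, ℍ[ℝ]) 𝓘(ℝ, ℍ[ℝ]) F z :=
    (h.contDiff.differentiable (by simp) z).mdifferentiableAt
  have h1 := mfderiv_comp z hf (hp z)
  have h2 := mfderiv_comp z (hp (F z)) hF
  have h3 : f ∘ proj Γ = proj Γ ∘ F := funext fun y => (h.proj_apply y).symm
  rw [h3, h2, mfderiv_proj, mfderiv_proj, mfderiv_eq_fderiv] at h1
  exact h1.symm

theorem lift_pullback_omegaM (h : IsSmoothLift f F) (z : ℍ[ℝ]) :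
    ((omegaM Γ).pullback f).lift z = pullOmega (fderiv ℝ F z) := by
  rw [Form.lift_eq, ← h.mfderiv_comp_eq]
  rfl

/-- The sign in `momentMap` cancels the one in `formStructure`, leaving a trace of the pullback of
`ω_V` against `A`. -/
theorem momentMap_eq (h : IsSmoothLift f F) (A : ℍ[ℝ] →L[ℝ] ℍ[ℝ]) (z : ℍ[ℝ]) :
    momentMap A (differential f) (proj Γ z) =
      1 / 2 * ∑ a, pullOmega (fderiv ℝ F z) ![A (frame a), frame a] := by
  rw [← h.mfderiv_comp_eq]
  have : ∀ a, inner ℝ (involution A (differential f) (proj Γ z) ((rho (proj Γ z)).symm (frame a)))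
      (differential f (proj Γ z) ((rho (proj Γ z)).symm (frame a))) =
      -pullOmega ((rho (f (proj Γ z)) : _ →L[ℝ] ℍ[ℝ]).comp
      ((mfderiv 𝓘(ℝ, ℍ[ℝ]) 𝓘(ℝ, ℍ[ℝ]) f (proj Γ z)).comp
        ((rho (proj Γ z)).symm : ℍ[ℝ] →L[ℝ] _))) ![A (frame a), frame a] := by
    intro a
    rw [pullOmega_apply, ← inner_neg_left, ← map_neg]
    rfl
  simp only [momentMap, innerOne, this, Finset.sum_neg_distrib]
  ring

end IsSmoothLift

/-- The zeros of the hyperKähler moment map are the maps which pull `ω_M` back to a self-dual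
form. -/
theorem hyperMomentMap_eq_zero_iff (f : SmoothMap Γ) :
    hyperMomentMap (differential f) = 0 ↔ ((omegaM Γ).pullback f).IsSelfDual := by
  obtain ⟨F, hF⟩ := exists_isSmoothLift f
  have h1 : hyperMomentMap (differential f) = 0 ↔ ∀ x, momentMap (leftMul qi) (differential f) x = 0 ∧
      momentMap (leftMul qj) (differential f) x = 0 ∧
      momentMap (leftMul qk) (differential f) x = 0 := by
    constructor
    · intro h x
      exact ⟨congrFun (congrFun h 0) x, congrFun (congrFun h 1) x, congrFun (congrFun h 2) x⟩
    · intro h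
      funext i x
      fin_cases i
      exacts [(h x).1, (h x).2.1, (h x).2.2]
  rw [h1, (proj_surjective Γ).forall, Form.isSelfDual_iff]
  refine forall_congr' fun z => ?_
  rw [hF.lift_pullback_omegaM, ← sum_pullOmega_eq_zero_iff]
  simp only [hF.momentMap_eq]
  simp

end Lifts

/-! ### Closed, coclosed and exact forms on `ℍ` -/

section FlatForms

theorem minSmoothness_two_le_infty : minSmoothness ℝ 2 ≤ (∞ : ℕ∞ω) := by
  rw [minSmoothness_of_isRCLikeNormedField]
  exact WithTop.coe_le_coe.2 (le_top : (2 : ℕ∞) ≤ ⊤)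

theorem fderiv_form_apply {k : ℕ} {β : ℍ[ℝ] → ℍ[ℝ] [⋀^Fin k]→L[ℝ] ℝ} {z : ℍ[ℝ]}
    (hβ : DifferentiableAt ℝ β z) (v : Fin k → ℍ[ℝ]) (w : ℍ[ℝ]) :
    fderiv ℝ (fun y => β y v) z w = fderiv ℝ β z w v := by
  rw [fderiv_continuousAlternatingMap_apply_const_apply hβ]

theorem extDeriv_two_form_apply (β : ℍ[ℝ] → ℍ[ℝ] [⋀^Fin 2]→L[ℝ] ℝ) (z u v w : ℍ[ℝ]) :
    extDeriv β z ![u, v, w] =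
      fderiv ℝ β z u ![v, w] - fderiv ℝ β z v ![u, w] + fderiv ℝ β z w ![u, v] := by
  have h0 : Fin.removeNth (0 : Fin 3) ![u, v, w] = ![v, w] := by
    funext i; fin_cases i <;> rfl
  have h1 : Fin.removeNth (1 : Fin 3) ![u, v, w] = ![u, w] := by
    funext i; fin_cases i <;> rfl
  have h2 : Fin.removeNth (2 : Fin 3) ![u, v, w] = ![u, v] := by
    funext i; fin_cases i <;> rfl
  rw [extDeriv, ContinuousAlternatingMap.alternatizeUncurryFin_apply, Fin.sum_univ_three, h0, h1, h2]
  simp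
  ring

theorem extDeriv_one_form_apply (η : ℍ[ℝ] → ℍ[ℝ] [⋀^Fin 1]→L[ℝ] ℝ) (z u v : ℍ[ℝ]) :
    extDeriv η z ![u, v] = fderiv ℝ η z u ![v] - fderiv ℝ η z v ![u] := by
  have h0 : Fin.removeNth (0 : Fin 2) ![u, v] = ![v] := by
    funext i; fin_cases i; rfl
  have h1 : Fin.removeNth (1 : Fin 2) ![u, v] = ![u] := by
    funext i; fin_cases i; rfl
  rw [extDeriv, ContinuousAlternatingMap.alternatizeUncurryFin_apply, Fin.sum_univ_two, h0, h1]
  simp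
  ring

theorem contDiff_form_apply {k : ℕ} {n : ℕ∞ω} {β : ℍ[ℝ] → ℍ[ℝ] [⋀^Fin k]→L[ℝ] ℝ}
    (hβ : ContDiff ℝ n β) (v : Fin k → ℍ[ℝ]) : ContDiff ℝ n fun z => β z v :=
  ContDiff.comp (g := ContinuousAlternatingMap.apply ℝ ℍ[ℝ] ℝ v)
    (ContinuousLinearMap.contDiff _) hβ

theorem contDiff_extDeriv {k : ℕ} {η : ℍ[ℝ] → ℍ[ℝ] [⋀^Fin k]→L[ℝ] ℝ} (hη : ContDiff ℝ ∞ η) :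
    ContDiff ℝ ∞ (extDeriv η) := by
  have h : extDeriv η = ContinuousAlternatingMap.alternatizeUncurryFinCLM ℝ ℍ[ℝ] ℝ ∘ fderiv ℝ η :=
    rfl
  rw [h]
  exact (ContinuousLinearMap.contDiff _).comp (hη.fderiv_right (m := ∞) (by simp))

/-- The equations are linear with constant coefficients, so they pass to derivatives. -/
theorem SelfDualEq.fderiv {β : ℍ[ℝ] → ℍ[ℝ] [⋀^Fin 2]→L[ℝ] ℝ} (hβ : Differentiable ℝ β)
    (h : ∀ z, SelfDualEq (β z)) (z w : ℍ[ℝ]) : SelfDualEq (fderiv ℝ β z w) := by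
  have hd : ∀ v, DifferentiableAt ℝ (fun y => β y v) z := fun v => by
    have := hβ z
    fun_prop
  refine ⟨?_, ?_, ?_⟩
  · rw [← fderiv_form_apply (hβ z), ← fderiv_form_apply (hβ z), ← add_apply,
      ← fderiv_add (hd _) (hd _)]
    have : ((fun y => β y ![frame 0, frame 1]) + fun y => β y ![frame 2, frame 3]) = fun _ => 0 :=
      funext fun y => (h y).1
    simp [this]
  · rw [← fderiv_form_apply (hβ z), ← fderiv_form_apply (hβ z), ← sub_apply,
      ← fderiv_sub (hd _) (hd _)]
    have : ((fun y => β y ![frame 0, frame 2]) - fun y => β y ![frame 1, frame 3]) = fun _ => 0 :=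
      funext fun y => (h y).2.1
    simp [this]
  · rw [← fderiv_form_apply (hβ z), ← fderiv_form_apply (hβ z), ← add_apply,
      ← fderiv_add (hd _) (hd _)]
    have : ((fun y => β y ![frame 0, frame 3]) + fun y => β y ![frame 1, frame 2]) = fun _ => 0 :=
      funext fun y => (h y).2.2
    simp [this]

/-- A closed self-dual form is coclosed. -/
theorem sum_fderiv_eq_zero_of_selfDual {β : ℍ[ℝ] → ℍ[ℝ] [⋀^Fin 2]→L[ℝ] ℝ}
    (hβ : Differentiable ℝ β) (h : ∀ z, SelfDualEq (β z)) (hd : ∀ z, extDeriv β z = 0)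
    (z : ℍ[ℝ]) (b : Fin 4) : ∑ a, fderiv ℝ β z (frame a) ![frame a, frame b] = 0 := by
  have hc : ∀ a b c, fderiv ℝ β z (frame a) ![frame b, frame c]
      - fderiv ℝ β z (frame b) ![frame a, frame c]
      + fderiv ℝ β z (frame c) ![frame a, frame b] = 0 := by
    intro a b c
    rw [← extDeriv_two_form_apply, hd]
    rfl
  -- Self-duality rewrites the component `b` of the divergence as, up to sign, `dβ` on the three
  -- other frame vectors; this is `δ = ± * d *` in coordinates.
  have hs := fun a => SelfDualEq.fderiv hβ h z (frame a)
  obtain ⟨a1, a2, a3⟩ := hs 0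
  obtain ⟨b1, b2, b3⟩ := hs 1
  obtain ⟨c1, c2, c3⟩ := hs 2
  obtain ⟨d1, d2, d3⟩ := hs 3
  have e1 := hc 0 1 2
  have e2 := hc 0 1 3
  have e3 := hc 0 2 3
  have e4 := hc 1 2 3
  have sw := fun (T : ℍ[ℝ] [⋀^Fin 2]→L[ℝ] ℝ) a b => two_form_swap T (frame a) (frame b)
  rw [Fin.sum_univ_four]
  fin_cases b
  · change fderiv ℝ β z (frame 0) ![frame 0, frame 0] + fderiv ℝ β z (frame 1) ![frame 1, frame 0]
      + fderiv ℝ β z (frame 2) ![frame 2, frame 0] + fderiv ℝ β z (frame 3) ![frame 3, frame 0] = 0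
    rw [two_form_self, sw _ 1 0, sw _ 2 0, sw _ 3 0]
    linarith
  · change fderiv ℝ β z (frame 0) ![frame 0, frame 1] + fderiv ℝ β z (frame 1) ![frame 1, frame 1]
      + fderiv ℝ β z (frame 2) ![frame 2, frame 1] + fderiv ℝ β z (frame 3) ![frame 3, frame 1] = 0
    rw [two_form_self, sw _ 2 1, sw _ 3 1]
    linarith
  · change fderiv ℝ β z (frame 0) ![frame 0, frame 2] + fderiv ℝ β z (frame 1) ![frame 1, frame 2]
      + fderiv ℝ β z (frame 2) ![frame 2, frame 2] + fderiv ℝ β z (frame 3) ![frame 3, frame 2] = 0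
    rw [two_form_self, sw _ 3 2]
    linarith
  · change fderiv ℝ β z (frame 0) ![frame 0, frame 3] + fderiv ℝ β z (frame 1) ![frame 1, frame 3]
      + fderiv ℝ β z (frame 2) ![frame 2, frame 3] + fderiv ℝ β z (frame 3) ![frame 3, frame 3] = 0
    rw [two_form_self]
    linarith

theorem codiff_eq_zero_of_selfDual {β : ℍ[ℝ] → ℍ[ℝ] [⋀^Fin 2]→L[ℝ] ℝ}
    (hβ : Differentiable ℝ β) (h : ∀ z, SelfDualEq (β z)) (hd : ∀ z, extDeriv β z = 0) :
    codiff (k := 1) β = 0 := by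
  funext z
  ext v
  have hv : v = ![v 0] := by funext i; fin_cases i; rfl
  have hsum : ∀ w : ℍ[ℝ], ∑ a, fderiv ℝ β z (frame a) ![frame a, w] = 0 := by
    intro w
    have hr : ∀ (T : ℍ[ℝ] [⋀^Fin 2]→L[ℝ] ℝ) (x : ℍ[ℝ]), T ![x, w] = w.re * T ![x, frame 0]
        + w.imI * T ![x, frame 1] + w.imJ * T ![x, frame 2] + w.imK * T ![x, frame 3] := by
      intro T x
      rw [two_form_swap]
      conv_lhs => rw [eq_sum_frame w]
      simp only [two_form_add_left, two_form_smul_left]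
      rw [two_form_swap T x (frame 0), two_form_swap T x (frame 1), two_form_swap T x (frame 2),
        two_form_swap T x (frame 3)]
      ring
    simp only [hr, Finset.sum_add_distrib, ← Finset.mul_sum,
      sum_fderiv_eq_zero_of_selfDual hβ h hd]
    simp
  simp only [codiff, ContinuousAlternatingMap.neg_apply, ContinuousAlternatingMap.sum_apply,
    ContinuousAlternatingMap.curryLeft_apply_apply]
  rw [hv]
  exact neg_eq_zero.2 (hsum (v 0))

end FlatForms

/-! ### Exact forms on `ℍ` with a periodic primitive. -/

section PeriodicForms

variable (Γ : Submodule ℤ ℍ[ℝ]) [DiscreteTopology Γ] [IsZLattice ℝ Γ]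

include Γ in
/-- A constant `2`-form which is the differential of a periodic form vanishes. -/
theorem eq_zero_of_extDeriv_periodic_eq_const {η : ℍ[ℝ] → ℍ[ℝ] [⋀^Fin 1]→L[ℝ] ℝ}
    (hη : ContDiff ℝ 1 η) (hper : ∀ z, ∀ w ∈ Γ, η (z + w) = η z) {κ : ℍ[ℝ] [⋀^Fin 2]→L[ℝ] ℝ}
    (h : ∀ z, extDeriv η z = κ) : κ = 0 := by
  refine two_form_eq_zero κ fun a b => ?_
  set c := κ ![frame a, frame b] with hc
  have hd := hη.differentiable one_ne_zero
  have hev : ∀ v, ContDiff ℝ 1 fun z => η z v := contDiff_form_apply hη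
  -- Multiplying `c = ∂_a η_b - ∂_b η_a` by the constant `c` makes the left side nonnegative while
  -- the right side stays a divergence of periodic functions.
  have h0 := eq_zero_of_eq_sum_fderiv_periodic Γ (Finset.univ : Finset (Fin 2))
    (h := ![fun z => c * η z ![frame b], fun z => -c * η z ![frame a]])
    (v := ![frame a, frame b]) (φ := fun _ => c ^ 2)
    (by
      intro i _
      fin_cases i
      exacts [contDiff_const.mul (hev _), contDiff_const.mul (hev _)])
    (by
      intro i _ z w hw
      fin_cases i <;> simp [hper z w hw])
    (by
      intro z
      have h1 : ∀ (r : ℝ) (v : Fin 1 → ℍ[ℝ]) (w : ℍ[ℝ]),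
          fderiv ℝ (fun z => r * η z v) z w = r * fderiv ℝ η z w v := by
        intro r v w
        rw [fderiv_const_mul ((hev v).differentiable one_ne_zero z), smul_apply,
          fderiv_form_apply (hd z), smul_eq_mul]
      have h2 : c = fderiv ℝ η z (frame a) ![frame b] - fderiv ℝ η z (frame b) ![frame a] := by
        rw [hc, ← h z, extDeriv_one_form_apply]
      rw [Fin.sum_univ_two]
      change c ^ 2 = fderiv ℝ (fun z => c * η z ![frame b]) z (frame a)
        + fderiv ℝ (fun z => -c * η z ![frame a]) z (frame b)
      rw [h1, h1]
      linear_combination c * h2)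
    (fun _ => sq_nonneg c) 0
  exact pow_eq_zero_iff (two_ne_zero) |>.1 h0

include Γ in
/-- The differential of a periodic form vanishes if it is self-dual. -/
theorem extDeriv_periodic_eq_zero_of_selfDual {η : ℍ[ℝ] → ℍ[ℝ] [⋀^Fin 1]→L[ℝ] ℝ}
    (hη : ContDiff ℝ ∞ η) (hper : ∀ z, ∀ w ∈ Γ, η (z + w) = η z)
    (h : ∀ z, SelfDualEq (extDeriv η z)) (z : ℍ[ℝ]) : extDeriv η z = 0 := by
  have hηd : Differentiable ℝ η := hη.differentiable (by simp)
  have hβ : ContDiff ℝ ∞ (extDeriv η) := contDiff_extDeriv hη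
  have hβd : Differentiable ℝ (extDeriv η) := hβ.differentiable (by simp)
  have hclosed : ∀ z, extDeriv (extDeriv η) z = 0 := fun z =>
    congrFun (extDeriv_extDeriv hη minSmoothness_two_le_infty) z
  have hco := sum_fderiv_eq_zero_of_selfDual hβd h hclosed
  have hev : ∀ v, ContDiff ℝ 1 fun z => η z v := contDiff_form_apply (hη.of_le (by simp))
  have hevβ : ∀ v, ContDiff ℝ 1 fun z => extDeriv η z v := contDiff_form_apply (hβ.of_le (by simp))
  have hperβ : ∀ z, ∀ w ∈ Γ, extDeriv η (z + w) = extDeriv η z := by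
    intro z w hw
    rw [extDeriv, extDeriv, fderiv_periodic fun z => hper z w hw]
  -- The field is `X_a = ∑_b η_b (dη)_{ab}`. In its divergence the terms with derivatives of `dη`
  -- cancel by coclosedness, and antisymmetry turns `∑ ∂_a η_b (dη)_{ab}` into `|dη|²`.
  have h0 := eq_zero_of_eq_sum_fderiv_periodic Γ (Finset.univ : Finset (Fin 4))
    (h := fun a z => ∑ b, η z ![frame b] * extDeriv η z ![frame a, frame b])
    (v := frame) (φ := fun z => innerTwo (extDeriv η z) (extDeriv η z))
    (fun a _ => ContDiff.sum fun b _ => (hev _).mul (hevβ _))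
    (fun a _ z w hw => by simp only [hper z w hw, hperβ z w hw])
    (by
      intro z
      have h1 : ∀ a, fderiv ℝ (fun z => ∑ b, η z ![frame b] * extDeriv η z ![frame a, frame b]) z
          (frame a) = ∑ b, (η z ![frame b] * fderiv ℝ (extDeriv η) z (frame a) ![frame a, frame b]
            + extDeriv η z ![frame a, frame b] * fderiv ℝ η z (frame a) ![frame b]) := by
        intro a
        have hd1 := fun v => (hev v).differentiable one_ne_zero z
        have hd2 := fun v => (hevβ v).differentiable one_ne_zero z
        rw [fderiv_fun_sum fun b _ => (hd1 _).fun_mul (hd2 _), sum_apply]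
        refine Finset.sum_congr rfl fun b _ => ?_
        rw [fderiv_fun_mul (hd1 _) (hd2 _), add_apply, smul_apply, smul_apply,
          fderiv_form_apply (hηd z), fderiv_form_apply (hβd z), smul_eq_mul, smul_eq_mul]
      have h2 : ∑ a, ∑ b, η z ![frame b] * fderiv ℝ (extDeriv η) z (frame a) ![frame a, frame b]
          = 0 := by
        rw [Finset.sum_comm]
        simp only [← Finset.mul_sum, hco z, mul_zero, Finset.sum_const_zero]
      simp only [h1, Finset.sum_add_distrib, h2, zero_add, innerTwo_apply]
      simp only [Fin.sum_univ_four, extDeriv_one_form_apply]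
      ring)
    (fun z => by
      have hs := fun a b => mul_self_nonneg (extDeriv η z ![frame a, frame b])
      rw [innerTwo_apply]
      linarith only [hs 0 1, hs 0 2, hs 0 3, hs 1 2, hs 1 3, hs 2 3]) z
  rw [innerTwo_apply] at h0
  have hz : ∀ a b : Fin 4, a < b → extDeriv η z ![frame a, frame b] = 0 := by
    intro a b hab
    refine mul_self_eq_zero.1 (le_antisymm ?_ (mul_self_nonneg _))
    fin_cases a <;> fin_cases b <;> first
      | exact absurd hab (by decide)
      | (simp only [Fin.zero_eta, Fin.mk_one, Fin.reduceFinMk]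
         linarith only [h0, mul_self_nonneg (extDeriv η z ![frame 0, frame 1]),
          mul_self_nonneg (extDeriv η z ![frame 0, frame 2]),
          mul_self_nonneg (extDeriv η z ![frame 0, frame 3]),
          mul_self_nonneg (extDeriv η z ![frame 1, frame 2]),
          mul_self_nonneg (extDeriv η z ![frame 1, frame 3]),
          mul_self_nonneg (extDeriv η z ![frame 2, frame 3])])
  refine two_form_eq_zero _ fun a b => ?_
  rcases lt_trichotomy a b with hab | rfl | hab
  · exact hz a b hab
  · exact two_form_self _ _
  · rw [two_form_swap, hz b a hab, neg_zero]

end PeriodicForms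

/-! ### Symplectic linear maps and the lattice -/

section Linear

theorem inner_rightI_swap (u v : ℍ[ℝ]) : inner ℝ (rightI u) v = -inner ℝ (rightI v) u :=
  two_form_swap omegaV u v

theorem rightI_rightI (u : ℍ[ℝ]) : rightI (rightI u) = -u := by
  change u * qi * qi = -u
  have : qi * qi = -1 := by
    have h : qi = frame 1 := rfl
    rw [h]
    ext <;> simp [Quaternion.re_mul, Quaternion.imI_mul, Quaternion.imJ_mul, Quaternion.imK_mul]
  rw [mul_assoc, this, mul_neg_one]

theorem two_form_ext {α β : ℍ[ℝ] [⋀^Fin 2]→L[ℝ] ℝ} (h : ∀ u v, α ![u, v] = β ![u, v]) : α = β := by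
  ext v
  have hv : v = ![v 0, v 1] := by funext i; fin_cases i <;> rfl
  rw [hv, h]

theorem pullOmega_eq_omegaV_iff {B : ℍ[ℝ] →L[ℝ] ℍ[ℝ]} :
    pullOmega B = omegaV ↔ ∀ u v, inner ℝ (rightI (B u)) (B v) = inner ℝ (rightI u) v := by
  constructor
  · intro h u v
    exact DFunLike.congr_fun h ![u, v]
  · intro h
    exact two_form_ext h

/-- A symplectic endomorphism is invertible. -/
theorem exists_equiv_of_pullOmega_eq {B : ℍ[ℝ] →L[ℝ] ℍ[ℝ]} (h : pullOmega B = omegaV) :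
    ∃ e : ℍ[ℝ] ≃L[ℝ] ℍ[ℝ], (e : ℍ[ℝ] →L[ℝ] ℍ[ℝ]) = B := by
  rw [pullOmega_eq_omegaV_iff] at h
  have hinj : Function.Injective (B : ℍ[ℝ] →ₗ[ℝ] ℍ[ℝ]) := by
    rw [injective_iff_map_eq_zero]
    intro u hu
    -- Pairing `u` with `u i` turns the symplectic form into `|u i|²`, so the kernel is trivial.
    have h1 := h u (rightI u)
    have h2 : B u = 0 := hu
    rw [h2, map_zero, inner_zero_left] at h1
    have h3 : rightI u = 0 := inner_self_eq_zero.1 h1.symm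
    rw [← neg_eq_zero, ← rightI_rightI, h3, map_zero]
  refine ⟨(LinearEquiv.ofInjectiveEndo _ hinj).toContinuousLinearEquiv, ?_⟩
  ext1 v
  rfl

/-- The symplectic form of `ℍ` as a bilinear form. -/
noncomputable def omegaBilin : LinearMap.BilinForm ℝ ℍ[ℝ] :=
  (innerₗ ℍ[ℝ]).comp (rightI : ℍ[ℝ] →ₗ[ℝ] ℍ[ℝ])

theorem omegaBilin_apply (u v : ℍ[ℝ]) : omegaBilin u v = inner ℝ (rightI u) v := rfl

theorem omegaBilin_nondegenerate : omegaBilin.Nondegenerate := by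
  have hl : ∀ u, (∀ v, omegaBilin u v = 0) → u = 0 := by
    intro u hu
    have h3 : rightI u = 0 := inner_self_eq_zero.1 (hu (rightI u))
    rw [← neg_eq_zero, ← rightI_rightI, h3, map_zero]
  refine ⟨hl, fun u hu => hl u fun v => ?_⟩
  rw [omegaBilin_apply, inner_rightI_swap, ← omegaBilin_apply, hu v, neg_zero]

variable {Γ : Submodule ℤ ℍ[ℝ]} [DiscreteTopology Γ] [IsZLattice ℝ Γ]

/-- A symplectic endomorphism which preserves the lattice maps it onto itself. -/
theorem exists_mem_map_eq_of_pullOmega_eq {A : ℍ[ℝ] →L[ℝ] ℍ[ℝ]} (hA : ∀ w ∈ Γ, A w ∈ Γ)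
    (h : pullOmega A = omegaV) {w : ℍ[ℝ]} (hw : w ∈ Γ) : ∃ w' ∈ Γ, A w' = w := by
  classical
  have := ZLattice.module_free ℝ Γ
  have := ZLattice.module_finite ℝ Γ
  let b := Module.Free.chooseBasis ℤ Γ
  let bR := b.ofZLatticeBasis ℝ Γ
  let a : Γ →ₗ[ℤ] Γ := ((A : ℍ[ℝ] →ₗ[ℝ] ℍ[ℝ]).restrictScalars ℤ).restrict hA
  have ha : ∀ x : Γ, ((a x : Γ) : ℍ[ℝ]) = A x := fun x => rfl
  set N := LinearMap.toMatrix b b a with hN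
  -- In a basis of the lattice `A` has an integer matrix `N`. Taking determinants in `Nᵀ Ω N = Ω`
  -- gives `(det N)² = 1`, so `N` is invertible over the integers.
  have hNR : LinearMap.toMatrix bR bR (A : ℍ[ℝ] →ₗ[ℝ] ℍ[ℝ]) =
      (Int.castRingHom ℝ).mapMatrix N := by
    ext i j
    rw [LinearMap.toMatrix_apply, RingHom.mapMatrix_apply, Matrix.map_apply, hN,
      LinearMap.toMatrix_apply]
    have h1 : (A : ℍ[ℝ] →ₗ[ℝ] ℍ[ℝ]) (bR j) = ((a (b j) : Γ) : ℍ[ℝ]) := by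
      rw [ha, Module.Basis.ofZLatticeBasis_apply]
      rfl
    rw [h1, Module.Basis.ofZLatticeBasis_repr_apply]
    rfl
  have hcomp : omegaBilin.comp (A : ℍ[ℝ] →ₗ[ℝ] ℍ[ℝ]) (A : ℍ[ℝ] →ₗ[ℝ] ℍ[ℝ]) = omegaBilin := by
    ext u v
    exact pullOmega_eq_omegaV_iff.1 h u v
  have hdet := congrArg (fun B => (LinearMap.BilinForm.toMatrix bR B).det) hcomp
  simp only [LinearMap.BilinForm.toMatrix_comp bR, Matrix.det_mul, Matrix.det_transpose, hNR,
    ← RingHom.map_det] at hdet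
  have hne := (LinearMap.BilinForm.nondegenerate_iff_det_ne_zero bR).1 omegaBilin_nondegenerate
  have hsq : (N.det : ℝ) * N.det = 1 := by
    refine mul_right_cancel₀ hne ?_
    simp only [eq_intCast] at hdet
    linear_combination hdet
  have hunit : IsUnit N.det := .of_mul_eq_one N.det (mod_cast hsq)
  obtain ⟨x, hx⟩ := (LinearEquiv.ofIsUnitDet hunit).surjective ⟨w, hw⟩
  exact ⟨x, x.2, congrArg Subtype.val hx⟩

end Linear

/-! ### The linear part of a map of the torus -/

section LinearPart

variable {Γ : Submodule ℤ ℍ[ℝ]} [DiscreteTopology Γ]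

/-- A continuous map from a connected space to a discrete lattice is constant. It makes the periods
of a lift independent of the base point and of the homotopy parameter. -/
theorem eq_of_continuous_of_mem {X : Type*} [TopologicalSpace X] [PreconnectedSpace X]
    {g : X → ℍ[ℝ]} (hg : Continuous g) (h : ∀ x, g x ∈ Γ) (x y : X) : g x = g y :=
  congrArg Subtype.val (PreconnectedSpace.constant ‹_›
    (f := fun x => (⟨g x, h x⟩ : Γ)) (hg.subtype_mk h) (x := x) (y := y))

/-- `F` is a smooth lift of `f` and `A` is the linear map which `f` induces on the universal
covering through its action on the fundamental group `Γ`. -/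
structure IsLiftWith (f : Torus Γ → Torus Γ) (F : ℍ[ℝ] → ℍ[ℝ]) (A : ℍ[ℝ] →L[ℝ] ℍ[ℝ]) : Prop
    extends IsSmoothLift f F where
  map_mem : ∀ w ∈ Γ, A w ∈ Γ
  add_mem : ∀ z, ∀ w ∈ Γ, F (z + w) = F z + A w

/-- The increment `F (z + w) - F z` lies in `Γ`, so it does not depend on `z` and is therefore
additive in `w`. A lattice basis, being a real basis of `ℍ`, extends it to a linear map. -/
theorem IsSmoothLift.exists_isLiftWith [IsZLattice ℝ Γ] {f : Torus Γ → Torus Γ} {F : ℍ[ℝ] → ℍ[ℝ]}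
    (h : IsSmoothLift f F) : ∃ A, IsLiftWith f F A := by
  have hmem : ∀ w ∈ Γ, ∀ z, F (z + w) - F z ∈ Γ := by
    intro w hw z
    rw [← proj_eq_iff, h.proj_apply, h.proj_apply, proj_add_of_mem z hw]
  have hcont := h.contDiff.continuous
  have hconst : ∀ w ∈ Γ, ∀ z, F (z + w) - F z = F w - F 0 := by
    intro w hw z
    have := eq_of_continuous_of_mem (g := fun z => F (z + w) - F z) (by fun_prop) (hmem w hw) z 0
    simpa using this
  let a : Γ →+ ℍ[ℝ] :=
    { toFun := fun w => F w - F 0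
      map_zero' := by simp
      map_add' := fun w w' => by
        have := hconst w' w'.2 w
        rw [Submodule.coe_add, ← this]
        abel }
  have := ZLattice.module_free ℝ Γ
  let b := Module.Free.chooseBasis ℤ Γ
  let A : ℍ[ℝ] →ₗ[ℝ] ℍ[ℝ] := (b.ofZLatticeBasis ℝ Γ).constr ℝ fun i => a (b i)
  have hA : ∀ w : Γ, A w = F w - F 0 := by
    have : (A.restrictScalars ℤ).comp Γ.subtype = a.toIntLinearMap := by
      refine b.ext fun i => ?_
      have : A (b.ofZLatticeBasis ℝ Γ i) = a (b i) := Module.Basis.constr_basis _ _ _ _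
      rw [Module.Basis.ofZLatticeBasis_apply] at this
      exact this
    exact fun w => LinearMap.congr_fun this w
  refine ⟨LinearMap.toContinuousLinearMap A, h, fun w hw => ?_, fun z w hw => ?_⟩
  · have := hmem w hw 0
    rw [zero_add, ← hA ⟨w, hw⟩] at this
    exact this
  · have := hconst w hw z
    rw [← hA ⟨w, hw⟩] at this
    rw [← sub_eq_iff_eq_add']
    exact this

theorem exists_isLiftWith [IsZLattice ℝ Γ] (f : SmoothMap Γ) : ∃ F A, IsLiftWith f F A := by
  obtain ⟨F, hF⟩ := exists_isSmoothLift f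
  exact ⟨F, hF.exists_isLiftWith⟩

end LinearPart

/-! ### The cohomology class of the pullback of the symplectic form -/

section Cohomology

/-- The `1`-form `v ↦ ω_V(u, (A + du / 2) v)`, whose differential is
`(A + u)^* ω_V - A^* ω_V`. -/
noncomputable def primitive (A : ℍ[ℝ] →L[ℝ] ℍ[ℝ]) (u : ℍ[ℝ] → ℍ[ℝ]) (z : ℍ[ℝ]) :
    ℍ[ℝ] [⋀^Fin 1]→L[ℝ] ℝ :=
  ContinuousAlternatingMap.ofSubsingletonLIE (0 : Fin 1)
    ((innerSL ℝ (rightI (u z))).comp (A + (1 / 2 : ℝ) • fderiv ℝ u z))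

theorem primitive_apply (A : ℍ[ℝ] →L[ℝ] ℍ[ℝ]) (u : ℍ[ℝ] → ℍ[ℝ]) (z v : ℍ[ℝ]) :
    primitive A u z ![v] = inner ℝ (rightI (u z)) (A v + (1 / 2 : ℝ) • fderiv ℝ u z v) := rfl

theorem contDiff_primitive (A : ℍ[ℝ] →L[ℝ] ℍ[ℝ]) {u : ℍ[ℝ] → ℍ[ℝ]} (hu : ContDiff ℝ ∞ u) :
    ContDiff ℝ ∞ (primitive A u) := by
  have h1 : ContDiff ℝ ∞ fun z => (innerSL ℝ (rightI (u z))).comp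
      (A + (1 / 2 : ℝ) • fderiv ℝ u z) := by
    refine ContDiff.clm_comp ?_ (contDiff_const.add
      ((hu.fderiv_right (m := ∞) (by simp)).const_smul (1 / 2 : ℝ)))
    exact (innerSL ℝ).contDiff.comp (rightI.contDiff.comp hu)
  exact (ContinuousAlternatingMap.ofSubsingletonLIE (𝕜 := ℝ) (E := ℍ[ℝ]) (F := ℝ)
    (0 : Fin 1)).toContinuousLinearEquiv.contDiff.comp h1

/-- Second derivatives of `u` cancel by symmetry. Antisymmetrization yields the cross terms of `A`
and `du` once and the term quadratic in `du` twice, whence the factor `1 / 2` in `primitive`. -/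
theorem extDeriv_primitive (A : ℍ[ℝ] →L[ℝ] ℍ[ℝ]) {u : ℍ[ℝ] → ℍ[ℝ]} (hu : ContDiff ℝ ∞ u)
    (z : ℍ[ℝ]) : extDeriv (primitive A u) z = pullOmega (A + fderiv ℝ u z) - pullOmega A := by
  have hd : DifferentiableAt ℝ (primitive A u) z :=
    (contDiff_primitive A hu).differentiable (by simp) z
  have hu1 : HasFDerivAt u (fderiv ℝ u z) z := (hu.differentiable (by simp) z).hasFDerivAt
  have hu2 : HasFDerivAt (fderiv ℝ u) (fderiv ℝ (fderiv ℝ u) z) z :=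
    ((hu.fderiv_right (m := ∞) (by simp)).differentiable (by simp) z).hasFDerivAt
  have hsymm : IsSymmSndFDerivAt ℝ u z :=
    hu.contDiffAt.isSymmSndFDerivAt minSmoothness_two_le_infty
  have hder : ∀ v w, fderiv ℝ (primitive A u) z w ![v] =
      inner ℝ (rightI (u z)) ((1 / 2 : ℝ) • fderiv ℝ (fderiv ℝ u) z w v) +
      inner ℝ (rightI (fderiv ℝ u z w)) (A v + (1 / 2 : ℝ) • fderiv ℝ u z v) := by
    intro v w
    rw [← fderiv_form_apply hd]
    simp only [primitive_apply]
    have h1 : HasFDerivAt (fun y => rightI (u y)) (rightI.comp (fderiv ℝ u z)) z :=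
      rightI.hasFDerivAt.comp z hu1
    have h2 : HasFDerivAt (fun y => A v + (1 / 2 : ℝ) • fderiv ℝ u y v)
        ((1 / 2 : ℝ) • (fderiv ℝ (fderiv ℝ u) z).flip v) z := by
      have h3 : HasFDerivAt (fun y => fderiv ℝ u y v) ((fderiv ℝ (fderiv ℝ u) z).flip v) z := by
        simpa using hu2.clm_apply (hasFDerivAt_const v z)
      exact (h3.const_smul (1 / 2 : ℝ)).const_add (A v)
    rw [(h1.inner ℝ h2).fderiv]
    rfl
  refine two_form_ext fun v w => ?_
  rw [extDeriv_one_form_apply, hder, hder, ContinuousAlternatingMap.sub_apply, pullOmega_apply,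
    pullOmega_apply, hsymm.eq v w]
  simp only [add_apply, map_add, inner_add_left, inner_add_right, inner_smul_right]
  rw [inner_rightI_swap (fderiv ℝ u z w) (A v),
    inner_rightI_swap (fderiv ℝ u z w) (fderiv ℝ u z v)]
  ring

variable {Γ : Submodule ℤ ℍ[ℝ]} [DiscreteTopology Γ]

namespace IsLiftWith

variable {f : SmoothMap Γ} {F : ℍ[ℝ] → ℍ[ℝ]} {A : ℍ[ℝ] →L[ℝ] ℍ[ℝ]}

theorem sub_periodic (h : IsLiftWith f F A) (z : ℍ[ℝ]) {w : ℍ[ℝ]} (hw : w ∈ Γ) :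
    F (z + w) - A (z + w) = F z - A z := by
  rw [h.add_mem z w hw, map_add]
  abel

theorem contDiff_sub (h : IsLiftWith f F A) : ContDiff ℝ ∞ fun z => F z - A z :=
  h.contDiff.sub A.contDiff

theorem primitive_periodic (h : IsLiftWith f F A) (z : ℍ[ℝ]) {w : ℍ[ℝ]} (hw : w ∈ Γ) :
    primitive A (fun z => F z - A z) (z + w) = primitive A (fun z => F z - A z) z := by
  have h1 : ∀ z, (fun z => F z - A z) (z + w) = (fun z => F z - A z) z :=
    fun z => h.sub_periodic z hw
  rw [primitive, primitive, fderiv_periodic h1]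
  simp only [h.sub_periodic z hw]

theorem extDeriv_primitive_eq (h : IsLiftWith f F A) (z : ℍ[ℝ]) :
    extDeriv (primitive A fun z => F z - A z) z =
      ((omegaM Γ).pullback f).lift z - pullOmega A := by
  rw [extDeriv_primitive A h.contDiff_sub, h.lift_pullback_omegaM,
    fderiv_fun_sub (h.contDiff.differentiable (by simp) z) A.differentiableAt, A.fderiv,
    add_sub_cancel]

/-- A map preserves the class of `ω_M` if and only if its linear part is symplectic. -/
theorem preservesClass_iff [IsZLattice ℝ Γ] (h : IsLiftWith f F A) :
    PreservesClass f ↔ pullOmega A = omegaV := by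
  have hp := contDiff_primitive A h.contDiff_sub
  constructor
  · rintro ⟨η, hη, hdη⟩
    have hlift : ∀ z, extDeriv η.lift z = ((omegaM Γ).pullback f).lift z - omegaV := by
      intro z
      rw [← Form.lift_omegaM (Γ := Γ) z, ← Form.lift_sub]
      exact (congrFun hdη z).symm
    have hη' : ContDiff ℝ ∞ η.lift := hη
    -- The two primitives have differentials `f^* ω - ω_V` and `f^* ω - A^* ω_V`, so their
    -- difference is a periodic primitive of the constant form `A^* ω_V - ω_V`.
    refine sub_eq_zero.1 (eq_zero_of_extDeriv_periodic_eq_const Γ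
      (η := η.lift - primitive A fun z => F z - A z)
      (κ := pullOmega A - omegaV) ?_ ?_ ?_)
    · exact (hη'.sub hp).of_le (by simp)
    · intro z w hw
      simp only [Pi.sub_apply, Form.lift_add_of_mem η z hw, h.primitive_periodic z hw]
    · intro z
      have h1 : extDeriv (η.lift - primitive A fun z => F z - A z) z =
          extDeriv η.lift z - extDeriv (primitive A fun z => F z - A z) z := by
        refine two_form_ext fun v w => ?_
        rw [ContinuousAlternatingMap.sub_apply]
        simp only [extDeriv_one_form_apply]
        rw [fderiv_sub (hη'.differentiable (by simp) z) (hp.differentiable (by simp) z)]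
        simp only [sub_apply, ContinuousAlternatingMap.sub_apply]
        ring
      rw [h1, hlift, h.extDeriv_primitive_eq]
      abel
  · intro hA
    obtain ⟨η, hη⟩ := Form.exists_lift_eq (Γ := Γ) (e := primitive A fun z => F z - A z)
      fun z w hw => h.primitive_periodic z hw
    refine ⟨η, ?_, ?_⟩
    · rw [Form.IsSmooth, hη]
      exact hp
    · rw [Form.IsExtDeriv, hη]
      funext z
      rw [h.extDeriv_primitive_eq, hA, Form.lift_sub, Form.lift_omegaM]

end IsLiftWith

end Cohomology

end HyperKahlerTorus

/-! ### Global inversion of proper local homeomorphisms -/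

section GlobalInversion

/-- A proper local homeomorphism from a connected space to a simply connected space is a
homeomorphism. -/
theorem IsLocalHomeomorph.exists_homeomorph_of_isProperMap {X Y : Type*} [TopologicalSpace X]
    [TopologicalSpace Y] [T2Space X] [PreconnectedSpace X] [T1Space Y]
    [SimplyConnectedSpace Y] [LocallyPathConnectedSpace Y] [Nonempty X] {f : X → Y}
    (hf : IsLocalHomeomorph f) (hp : IsProperMap f) : ∃ e : X ≃ₜ Y, ⇑e = f := by
  -- The fibres are compact and discrete, hence finite; a closed local homeomorphism with finite
  -- fibres is a covering.
  have hcov : IsCoveringMap f := by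
    rw [isCoveringMap_iff_isCoveringMapOn_univ]
    refine hp.isClosedMap.isCoveringMapOn_of_isLocalHomeomorphOn (fun y _ => ?_) ?_
    · refine (hp.isCompact_preimage isCompact_singleton).finite
        (IsDiscrete.of_openPartialHomeomorph f subset_rfl fun x _ => ?_)
      obtain ⟨φ, hφ, h⟩ := hf x
      exact ⟨φ, hφ, h.symm⟩
    · rw [Set.preimage_univ]
      exact isLocalHomeomorph_iff_isLocalHomeomorphOn_univ.1 hf
  -- Since `Y` is simply connected, its identity lifts to a section through any `x`. By uniqueness
  -- of lifts on the connected space `X`, such a section is also a left inverse of `f`.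
  have hsec : ∀ x, ∃ s : C(Y, X), s (f x) = x ∧ f ∘ s = id := fun x =>
    (hcov.existsUnique_continuousMap_lifts (ContinuousMap.id Y) (f x) x rfl).exists
  have hinj : Function.Injective f := by
    intro x x' hxx
    obtain ⟨s, hs, hfs⟩ := hsec x'
    have h1 : s ∘ f = id := hcov.eq_of_comp_eq (s.continuous.comp hf.continuous) continuous_id
      (by rw [← Function.comp_assoc, hfs]; rfl) x' hs
    exact (congrFun h1 x).symm.trans ((congrArg s hxx).trans hs)
  have hsurj : Function.Surjective f := by
    obtain ⟨s, -, hfs⟩ := hsec (Classical.arbitrary X)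
    exact fun y => ⟨s y, congrFun hfs y⟩
  exact ⟨hf.toHomeomorphOfBijective ⟨hinj, hsurj⟩, rfl⟩

end GlobalInversion

namespace HyperKahlerTorus

open scoped unitInterval

/-! ### Symplectic lifts, homotopies and the main equivalences. -/

section SymplecticMaps

variable {Γ : Submodule ℤ ℍ[ℝ]} [DiscreteTopology Γ]

namespace IsLiftWith

variable {f g : SmoothMap Γ} {F : ℍ[ℝ] → ℍ[ℝ]} {A : ℍ[ℝ] →L[ℝ] ℍ[ℝ]}

/-- `F - A` is periodic, hence bounded, and the invertible map `A` sends infinity to infinity. -/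
theorem isProperMap [IsZLattice ℝ Γ] (h : IsLiftWith f F A) (hA : pullOmega A = omegaV) :
    IsProperMap F := by
  obtain ⟨e, rfl⟩ := exists_equiv_of_pullOmega_eq hA
  have hc := h.contDiff.continuous
  obtain ⟨C, hC⟩ := exists_norm_le_of_periodic Γ h.contDiff_sub.continuous
    fun z w hw => h.sub_periodic z hw
  refine isProperMap_iff_tendsto_cocompact.2 ⟨hc, ?_⟩
  rw [← Metric.cobounded_eq_cocompact, ← tendsto_norm_atTop_iff_cobounded]
  have h1 : Filter.Tendsto (fun z => ‖e z‖ - C) (Bornology.cobounded ℍ[ℝ]) Filter.atTop := by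
    refine Filter.tendsto_atTop_add_const_right _ (-C) ?_
    rw [tendsto_norm_atTop_iff_cobounded, Metric.cobounded_eq_cocompact]
    exact e.toHomeomorph.isClosedEmbedding.tendsto_cocompact
  refine Filter.tendsto_atTop_mono (fun z => ?_) h1
  have h2 := hC z
  have h3 := norm_sub_norm_le (e z) (F z)
  rw [norm_sub_rev] at h3
  have h4 : ‖F z - e z‖ ≤ C := h2
  linarith

/-- The inverse function theorem makes `F` a local homeomorphism. Properness makes it global, and
invertible derivatives make the inverse smooth. -/
theorem exists_inverse [IsZLattice ℝ Γ] (h : IsLiftWith f F A) (hA : pullOmega A = omegaV)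
    (hF : ∀ z, pullOmega (fderiv ℝ F z) = omegaV) :
    ∃ G : ℍ[ℝ] → ℍ[ℝ], ContDiff ℝ ∞ G ∧ (∀ z, G (F z) = z) ∧ ∀ z, F (G z) = z := by
  choose F' hF' using fun z => exists_equiv_of_pullOmega_eq (hF z)
  have hstrict : ∀ z, HasStrictFDerivAt F (F' z : ℍ[ℝ] →L[ℝ] ℍ[ℝ]) z := fun z => by
    rw [hF']
    exact h.contDiff.hasStrictFDerivAt (by simp)
  have hloc : IsLocalHomeomorph F := IsLocalHomeomorph.mk F fun z =>
    ⟨(hstrict z).toOpenPartialHomeomorph F, (hstrict z).mem_toOpenPartialHomeomorph_source,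
      fun _ _ => rfl⟩
  obtain ⟨e, he⟩ := hloc.exists_homeomorph_of_isProperMap (h.isProperMap hA)
  refine ⟨e.symm, ?_, fun z => ?_, fun z => ?_⟩
  · refine e.contDiff_symm (f₀' := F') (fun z => ?_) ?_
    · rw [he]
      exact (hstrict z).hasFDerivAt
    · rw [he]
      exact h.contDiff
  · rw [← he, e.symm_apply_apply]
  · rw [← he, e.apply_symm_apply]

/-- A map with symplectic linear part which preserves the symplectic form is a diffeomorphism. -/
theorem isSymplecticDiffeo [IsZLattice ℝ Γ] (h : IsLiftWith f F A) (hA : pullOmega A = omegaV)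
    (hf : (omegaM Γ).pullback f = omegaM Γ) : IsSymplecticDiffeo f := by
  refine ⟨?_, hf⟩
  obtain ⟨G, hG, hGF, hFG⟩ := h.exists_inverse hA fun z => by
    rw [← h.lift_pullback_omegaM, hf, Form.lift_omegaM]
  obtain ⟨g, hg⟩ := exists_smoothMap_of_lift (Γ := Γ) hG fun z w hw => by
    -- The inverse descends because `A` maps `Γ` onto `Γ`: a period `A w'` of the target comes from
    -- the period `w'`.
    obtain ⟨w', hw', rfl⟩ := exists_mem_map_eq_of_pullOmega_eq h.map_mem hA hw
    have : G (z + A w') = G z + w' := by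
      rw [← hGF (G z + w'), h.add_mem _ _ hw', hFG]
    rw [this, add_sub_cancel_left]
    exact hw'
  refine ⟨⟨⟨f, g, fun x => ?_, fun x => ?_⟩, f.contMDiff, g.contMDiff⟩, fun x => rfl⟩
  · obtain ⟨z, rfl⟩ := proj_surjective Γ x
    rw [← h.proj_apply, ← hg.proj_apply, hGF]
  · obtain ⟨z, rfl⟩ := proj_surjective Γ x
    rw [← hg.proj_apply, ← h.proj_apply, hFG]

/-- Two maps with the same linear part `A`, one of which is covered by `A`, are homotopic. -/
theorem homotopic_linear (h : IsLiftWith f F A) (hg : IsSmoothLift g A) :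
    ContinuousMap.Homotopic (⟨f, f.contMDiff.continuous⟩ : C(Torus Γ, Torus Γ))
      ⟨g, g.contMDiff.continuous⟩ := by
  let u : Torus Γ → ℍ[ℝ] := fun x =>
    F (Function.surjInv (proj_surjective Γ) x) - A (Function.surjInv (proj_surjective Γ) x)
  have hu : ∀ z, u (proj Γ z) = F z - A z := by
    intro z
    have h1 := Function.surjInv_eq (proj_surjective Γ) (proj Γ z)
    have h2 := h.sub_periodic (Function.surjInv (proj_surjective Γ) (proj Γ z))
      ((proj_eq_iff Γ).1 h1)
    rw [add_sub_cancel] at h2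
    exact h2.symm
  have huc : Continuous u := by
    have hq : Topology.IsQuotientMap (proj Γ) :=
      (isCoveringMap_proj Γ).isQuotientMap (proj_surjective Γ)
    rw [hq.continuous_iff]
    exact h.contDiff_sub.continuous.congr fun z => (hu z).symm
  have hpc : Continuous (proj Γ) := contMDiff_proj.continuous
  have hfc : Continuous f := f.contMDiff.continuous
  -- The periodic part `u = F - A` descends to `M`, so subtracting `t u` in the group `M` deforms
  -- `F` linearly to `A`.
  refine ⟨⟨⟨fun q => f q.2 - proj Γ ((q.1 : ℝ) • u q.2), ?_⟩, fun x => ?_, fun x => ?_⟩⟩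
  · exact (hfc.comp continuous_snd).sub (hpc.comp ((continuous_subtype_val.comp
      continuous_fst).smul (huc.comp continuous_snd)))
  · change f x - proj Γ ((0 : ℝ) • u x) = f x
    rw [zero_smul]
    exact sub_zero _
  · change f x - proj Γ ((1 : ℝ) • u x) = g x
    obtain ⟨z, rfl⟩ := proj_surjective Γ x
    rw [one_smul, hu, ← h.proj_apply, ← hg.proj_apply]
    change proj Γ (F z - (F z - A z)) = _
    rw [sub_sub_cancel]

/-- Homotopic maps have the same linear part. -/
theorem of_homotopic (h : IsLiftWith f F A)
    (hfg : ContinuousMap.Homotopic (⟨f, f.contMDiff.continuous⟩ : C(Torus Γ, Torus Γ))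
      ⟨g, g.contMDiff.continuous⟩) : ∃ G, IsLiftWith g G A := by
  obtain ⟨H⟩ := hfg
  let Hp : C(I × ℍ[ℝ], Torus Γ) := ⟨fun q => H (q.1, proj Γ q.2), by
    have := (contMDiff_proj (Γ := Γ)).continuous
    fun_prop⟩
  have H0 : ∀ z, Hp (0, z) = proj Γ ((⟨F, h.contDiff.continuous⟩ : C(ℍ[ℝ], ℍ[ℝ])) z) := by
    intro z
    change H (0, proj Γ z) = proj Γ (F z)
    rw [H.apply_zero, h.proj_apply]
    rfl
  let K := (isCoveringMap_proj Γ).liftHomotopy Hp _ H0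
  have hK : ∀ t z, proj Γ (K (t, z)) = H (t, proj Γ z) := fun t z =>
    congrFun ((isCoveringMap_proj Γ).liftHomotopy_lifts Hp _ H0) (t, z)
  have hK0 : ∀ z, K (0, z) = F z := (isCoveringMap_proj Γ).liftHomotopy_zero Hp _ H0
  have hg : IsSmoothLift g fun z => K (1, z) := by
    refine .of_continuous g (by fun_prop) fun z => ?_
    rw [hK, H.apply_one]
    rfl
  refine ⟨_, hg, h.map_mem, fun z w hw => ?_⟩
  -- The increment along `w` of the lifted homotopy is continuous in `t` with values in `Γ`, so at
  -- `t = 1` it still equals `A w`.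
  have hconst := eq_of_continuous_of_mem (Γ := Γ) (g := fun t : I => K (t, z + w) - K (t, z))
    (by fun_prop) (fun t => by
      rw [← proj_eq_iff, hK, hK, proj_add_of_mem z hw]) 1 0
  simp only [hK0, h.add_mem z w hw, add_sub_cancel_left] at hconst
  exact sub_eq_iff_eq_add'.1 hconst

end IsLiftWith

theorem IsSymplecticDiffeo.preservesClass {g : SmoothMap Γ} (hg : IsSymplecticDiffeo g) :
    PreservesClass g := by
  have h0 : (0 : Form Γ 1).lift = fun _ => 0 := rfl
  refine ⟨0, ?_, ?_⟩
  · rw [Form.IsSmooth, h0]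
    exact contDiff_const
  · rw [Form.IsExtDeriv, hg.2, sub_self, h0]
    funext z
    refine two_form_ext fun u v => ?_
    rw [extDeriv_one_form_apply, fderiv_fun_const]
    simp
    rfl

variable [IsZLattice ℝ Γ]

/-- A map is homotopic to a symplectic diffeomorphism if and only if it preserves the class of
`ω_M`. -/
theorem isHomotopicToSymplectic_iff (f : SmoothMap Γ) :
    IsHomotopicToSymplectic f ↔ PreservesClass f := by
  obtain ⟨F, A, h⟩ := exists_isLiftWith f
  constructor
  · rintro ⟨g, hg, hfg⟩
    obtain ⟨G, hG⟩ := h.of_homotopic hfg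
    exact h.preservesClass_iff.2 (hG.preservesClass_iff.1 hg.preservesClass)
  · intro hf
    have hA := h.preservesClass_iff.1 hf
    -- The symplectic representative of the homotopy class is the map induced by `A` itself.
    obtain ⟨g, hg⟩ := exists_smoothMap_of_lift (Γ := Γ) A.contDiff fun z w hw => by
      rw [map_add, add_sub_cancel_left]
      exact h.map_mem w hw
    have hgA : IsLiftWith g A A := ⟨hg, h.map_mem, fun z w _ => map_add A z w⟩
    refine ⟨g, hgA.isSymplecticDiffeo hA (Form.ext_lift fun z => ?_), h.homotopic_linear hg⟩
    rw [hg.lift_pullback_omegaM, A.fderiv, hA, Form.lift_omegaM]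

/-- An exact self-dual form vanishes. -/
theorem Form.eq_zero_of_isExact_of_isSelfDual {α : Form Γ 2} (hα : Form.IsExact (k := 1) α)
    (hsd : α.IsSelfDual) : α = 0 := by
  obtain ⟨η, hη, hd⟩ := hα
  rw [Form.isSelfDual_iff, hd] at hsd
  refine Form.ext_lift fun z => ?_
  rw [hd, extDeriv_periodic_eq_zero_of_selfDual Γ hη
    (fun z w hw => Form.lift_add_of_mem η z hw) hsd z]
  rfl

/-- Among the maps which preserve the class of `ω_M`, the symplectic diffeomorphisms are the zeros
of the moment map. -/
theorem isSymplecticDiffeo_iff_of_preservesClass {f : SmoothMap Γ} (hf : PreservesClass f) :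
    IsSymplecticDiffeo f ↔ hyperMomentMap (differential f) = 0 := by
  rw [hyperMomentMap_eq_zero_iff]
  constructor
  · intro h
    rw [h.2, Form.isSelfDual_iff]
    intro z
    rw [Form.lift_omegaM]
    exact selfDualEq_omegaV
  · intro h
    obtain ⟨F, A, hF⟩ := exists_isLiftWith f
    refine hF.isSymplecticDiffeo (hF.preservesClass_iff.1 hf) (sub_eq_zero.1 ?_)
    -- As `ω_V` is self-dual, so is the exact form `f^* ω_M - ω_M`.
    refine Form.eq_zero_of_isExact_of_isSelfDual hf ?_
    rw [Form.isSelfDual_iff] at h ⊢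
    intro z
    rw [Form.lift_sub, Form.lift_omegaM]
    exact (h z).sub selfDualEq_omegaV

/-- If the pullback of `ω_M` is self-dual, it is harmonic. -/
theorem isHarmonic_pullback_of_isSelfDual {f : SmoothMap Γ}
    (hf : ((omegaM Γ).pullback f).IsSelfDual) :
    Form.IsHarmonic (k := 1) ((omegaM Γ).pullback f) := by
  obtain ⟨F, A, h⟩ := exists_isLiftWith f
  -- Writing the lift as an exact form plus a constant one gives both smoothness and closedness.
  have hp := contDiff_primitive A h.contDiff_sub
  have hlift : ((omegaM Γ).pullback f).lift =
      fun z => extDeriv (primitive A fun z => F z - A z) z + pullOmega A := by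
    funext z
    rw [h.extDeriv_primitive_eq, sub_add_cancel]
  have hsmooth : ContDiff ℝ ∞ ((omegaM Γ).pullback f).lift := by
    rw [hlift]
    exact (contDiff_extDeriv hp).add contDiff_const
  have hclosed : ∀ z, extDeriv ((omegaM Γ).pullback f).lift z = 0 := by
    intro z
    rw [hlift, extDeriv, fderiv_add_const]
    exact congrFun (extDeriv_extDeriv hp minSmoothness_two_le_infty) z
  rw [Form.isSelfDual_iff] at hf
  refine ⟨hsmooth, fun z => ?_⟩
  rw [codiff_eq_zero_of_selfDual (hsmooth.differentiable (by simp)) hf hclosed, funext hclosed]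
  have h1 : extDeriv (0 : ℍ[ℝ] → ℍ[ℝ] [⋀^Fin 1]→L[ℝ] ℝ) z = 0 := by
    refine two_form_ext fun u v => ?_
    rw [extDeriv_one_form_apply, fderiv_zero]
    simp
  have h2 : codiff (k := 2) (fun _ => 0) z = 0 := by
    simp [codiff]
  rw [h1]
  exact (zero_add _).trans h2

end SymplecticMaps

end HyperKahlerTorus

open HyperKahlerTorus
theorem theoremB (Γ : Submodule ℤ ℍ[ℝ]) [DiscreteTopology Γ] [IsZLattice ℝ Γ] :
    -- a smooth map is homotopic to a symplectic diffeomorphism iff it preserves the class of `ω_M`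
    (∀ f : SmoothMap Γ, IsHomotopicToSymplectic f ↔ PreservesClass f) ∧
    -- for such a map: symplectic diffeomorphism iff zero of the moment map
    (∀ f : SmoothMap Γ, IsHomotopicToSymplectic f →
      (IsSymplecticDiffeo f ↔ hyperMomentMap (differential f) = 0)) ∧
    (∀ f : SmoothMap Γ, PreservesClass f →
      (IsSymplecticDiffeo f ↔ hyperMomentMap (differential f) = 0)) ∧
    -- for every smooth map: zero of the moment map iff the pullback is self-dual (and harmonic)
    (∀ f : SmoothMap Γ, hyperMomentMap (differential f) = 0 ↔ ((omegaM Γ).pullback f).IsSelfDual) ∧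
    (∀ f : SmoothMap Γ, hyperMomentMap (differential f) = 0 ↔
      ((omegaM Γ).pullback f).IsSelfDual ∧ Form.IsHarmonic (k := 1) ((omegaM Γ).pullback f)) ∧
    -- an exact self-dual form vanishes
    (∀ α : Form Γ 2, Form.IsExact (k := 1) α → α.IsSelfDual → α = 0) :=
  ⟨isHomotopicToSymplectic_iff,
    fun f hf => isSymplecticDiffeo_iff_of_preservesClass ((isHomotopicToSymplectic_iff f).1 hf),
    fun _ hf => isSymplecticDiffeo_iff_of_preservesClass hf,
    hyperMomentMap_eq_zero_iff,
    fun f => (hyperMomentMap_eq_zero_iff f).trans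
      ⟨fun h => ⟨h, isHarmonic_pullback_of_isSelfDual h⟩, And.left⟩,
    fun _ => Form.eq_zero_of_isExact_of_isSelfDual⟩
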